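/- Conventions. $\log$ is the natural logarithm. A subgraph $H\subseteq G$ on the same vertex set is a \emph{$3$-spanner} of an unweighted graph $G$ if $\mathrm{dist}_H(s,t)\le 3\,\mathrm{dist}_G(s,t)$ for all vertices $s,t$. An \emph{adjacency oracle} for $H$ is a data structure, left in memory by a randomized preprocessing algorithm, from which a deterministic query algorithm, without access to $G$, decides for every edge $(s,t)\in E(G)$ whether $(s,t)\in E(H)$, in $O(\log^{k} n)$ time for a constant $k$. Time is counted on a random access machine with unit-cost elementary operations, biased coins and uniform random choices, access to the degree of a vertex and to the entries of its adjacency list (in arbitrary order), and dictionaries (initially empty) whose operations cost $\lfloor\log_2 n\rfloor+1$ steps on an $n$-vertex input. Construction. Let $C\ge 1$ and let $G=(V,E)$ be a simple graph on $n\ge 1$ vertices with $D/C\le\deg(v)\le CD$ for all $v\in V$; $C$, $D$ and a parameter $r\ge1$ are given. If $D\le n^{1/2}$, every query is answered YES. Otherwise, preprocess as follows. (1) Each vertex $v$, independently with probability $\min\{1,\,100C\log n/D\}$, becomes the center of a new cluster $C_v\ni v$. (2) For each center $c$ in turn, and each neighbor $w$ of $c$: if $w$ is in no cluster yet, put $w$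 into the cluster of $c$ and record the edge $(c,w)$. (3) For each $v\in V$, sample $\lceil 100Cr\log n\rceil$ incident edges uniformly without replacement (all incident edges, if there are fewer). For each sampled edge $(v,w)$: if $w$ is in a different cluster than $v$ and no edge from $v$ to the cluster of $w$ has been recorded for $v$ yet, record that $v$ is adjacent to the cluster of $w$, and record the edge $(v,w)$. A query $(s,t)$ is answered YES if $(s,t)$ was recorded, or if $s,t$ are in different clusters, $s$ was not recorded as adjacent to the cluster of $t$, and $t$ was not recorded as adjacent to the cluster of $s$. Otherwise it is answered NO. Theorem. There are absolute constants $c>0$ and $k\in\mathbb N$, and for every $C\ge1$ a constant $K=K(C)>0$, such that for all $n\ge 1$, $G$, $D$ as above (and every adjacency list representation of $G$) the following hold. (a) For every real $r$ with $1\le r\le CD$, with probability at least $1-1/n^{c}$ the preprocessing takes at most $K\log^k(n)\cdot nr$ steps, and the result is an adjacency oracle, with query time at most $K\log^k(n)$, for a $3$-spanner of $G$ with at most $K\log^k(n)\cdot n^2/r$ edges. (b) For $r=n^{1/2}$, with probability at least $1-1/n^{c}$ the preprocessing takes at most $K\log^k(n)\cdot n^{3/2}$ steps, and the result is an adjacency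 oracle, with query time at most $K\log^k(n)$, for a $3$-spanner of $G$ with at most $K\log^k(n)\cdot n^{3/2}$ edges. -/

import Mathlib

namespace SpannerOracle

/-! ## Spanners -/

/-- `H` is a `k`-spanner of the unweighted graph `G`: an edge-subgraph on the same vertices whose
distances (`⊤` between different components) exceed those of `G` by a factor of at most `k`. -/
def IsSpanner {V : Type*} (k : ℕ) (G H : SimpleGraph V) : Prop :=
  H ≤ G ∧ ∀ s t : V, H.edist s t ≤ (k : ℕ∞) * G.edist s t

/-! ## The input: an adjacency list -/

/-- An adjacency list representation of `G`: for every vertex, an array that lists its neighbours,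
each exactly once, in an arbitrary order. -/
structure AdjList {n : ℕ} (G : SimpleGraph (Fin n)) where
  /-- The array of neighbours of a vertex. -/
  nbrs : Fin n → List (Fin n)
  nodup : ∀ v, (nbrs v).Nodup
  mem_iff : ∀ v w, w ∈ nbrs v ↔ G.Adj v w

/-- The length of the array of the vertex `v` (`0` if `v` is not a vertex). -/
def AdjList.deg {n : ℕ} {G : SimpleGraph (Fin n)} (L : AdjList G) (v : ℕ) : ℕ :=
  if h : v < n then (L.nbrs ⟨v, h⟩).length else 0

/-- Entry `i` of the array of the vertex `v` (`0` if there is no such entry). -/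
def AdjList.nbr {n : ℕ} {G : SimpleGraph (Fin n)} (L : AdjList G) (v i : ℕ) : ℕ :=
  if h : v < n then ((L.nbrs ⟨v, h⟩).map Fin.val).getD i 0 else 0

/-! ## The machine: a randomized random access machine with a step count

Programs are finite syntax trees. A machine has finitely many registers and finitely many
dictionaries, whose keys are pairs of numbers and in which an absent key reads as `0`; initially all
dictionaries are empty. The only arithmetic operations are addition and truncated subtraction.

Every elementary operation costs one step, except that an access to a dictionary costs
`⌊log₂ n⌋ + 1` steps on an `n`-vertex input, as for a balanced search tree (so no
initialization of memory is needed, and only the cells that are used are paid for). -/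

/-- Registers. Register `n` initially holds the number of vertices; the arguments of a query are
placed in the registers `s` and `t`. -/
inductive Reg
  | n | s | t | v | w | d | m | i | j | a | b
  deriving DecidableEq

/-- Dictionaries. -/
inductive Dict
  /-- `cluster[v, 0]` is `c + 1` if `v` is in the cluster with centre `c`, and `0` if `v` is
  unclustered. -/
  | cluster
  /-- `recorded[v, w] ≠ 0` if the edge `{v, w}` was recorded. -/
  | recorded
  /-- `meets[v, c + 1] ≠ 0` if `v` was recorded as adjacent to the cluster with centre `c`. -/
  | meets
  /-- Row `v` holds the entries moved so far when the array of neighbours of `v` is shuffled. -/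
  | shuffle
  /-- `keepAll[0, 0] ≠ 0` if every query is to be answered YES. -/
  | keepAll
  deriving DecidableEq

/-- Contents of the registers and of the dictionaries. -/
structure State where
  reg : Reg → ℕ
  mem : Dict → ℕ → ℕ → ℕ

/-- Assignment of a value to a register. -/
def State.setReg (σ : State) (x : Reg) (k : ℕ) : State :=
  { σ with reg := Function.update σ.reg x k }

/-- Storing a value under a key of a dictionary. -/
def State.setMem (σ : State) (A : Dict) (i j k : ℕ) : State :=
  { σ with
    mem := Function.update σ.mem A
      (Function.update (σ.mem A) i (Function.update (σ.mem A i) j k)) }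

/-- The initial state on an `n`-vertex input. -/
def State.init (n : ℕ) : State where
  reg := fun x => if x = Reg.n then n else 0
  mem := fun _ _ _ => 0

/-- The cost of one access to a dictionary, on an `n`-vertex input. -/
def accessCost (n : ℕ) : ℕ := Nat.log 2 n + 1

/-- Expressions; they can read registers and dictionaries, but not the input graph. -/
inductive Expr
  | const (k : ℕ)
  | reg (x : Reg)
  | add (e f : Expr)
  | sub (e f : Expr)
  | read (A : Dict) (i j : Expr)

/-- The value of an expression. -/
def Expr.eval (σ : State) : Expr → ℕ
  | .const k => k
  | .reg x => σ.reg x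
  | .add e f => e.eval σ + f.eval σ
  | .sub e f => e.eval σ - f.eval σ
  | .read A i j => σ.mem A (i.eval σ) (j.eval σ)

/-- The number of steps taken by the evaluation of an expression. -/
def Expr.cost (n : ℕ) : Expr → ℕ
  | .const _ => 1
  | .reg _ => 1
  | .add e f => e.cost n + f.cost n + 1
  | .sub e f => e.cost n + f.cost n + 1
  | .read _ i j => i.cost n + j.cost n + accessCost n

/-- Boolean tests; they can read registers and dictionaries, but not the input graph. -/
inductive Test
  | eq (e f : Expr)
  | lt (e f : Expr)
  | not (p : Test)
  | and (p q : Test)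
  | or (p q : Test)

/-- The outcome of a test. -/
def Test.eval (σ : State) : Test → Bool
  | .eq e f => decide (e.eval σ = f.eval σ)
  | .lt e f => decide (e.eval σ < f.eval σ)
  | .not p => !(p.eval σ)
  | .and p q => p.eval σ && q.eval σ
  | .or p q => p.eval σ || q.eval σ

/-- The number of steps taken by a test. -/
def Test.cost (n : ℕ) : Test → ℕ
  | .eq e f => e.cost n + f.cost n + 1
  | .lt e f => e.cost n + f.cost n + 1
  | .not p => p.cost n + 1
  | .and p q => p.cost n + q.cost n + 1
  | .or p q => p.cost n + q.cost n + 1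

/-- Programs. -/
inductive Cmd
  | skip
  /-- `x := e` -/
  | assign (x : Reg) (e : Expr)
  /-- `A[i, j] := e` -/
  | write (A : Dict) (i j e : Expr)
  /-- `x :=` the degree of the vertex `v` -/
  | degree (x : Reg) (v : Expr)
  /-- `x :=` entry `i` of the array of neighbours of the vertex `v` -/
  | neighbor (x : Reg) (v i : Expr)
  /-- `x := 1` with probability `p` (truncated to `[0, 1]`), otherwise `x := 0` -/
  | coin (x : Reg) (p : ℝ)
  /-- `x :=` a uniformly random element of `{0, …, e - 1}` (`0` if `e = 0`) -/
  | random (x : Reg) (e : Expr)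
  | seq (c c' : Cmd)
  | ite (p : Test) (c c' : Cmd)
  /-- `for x = 0, …, e - 1 do c`, where `e` is evaluated once, at the start -/
  | loop (x : Reg) (e : Expr) (c : Cmd)

/-- A coin that shows `true` with probability `p`, truncated to `[0, 1]`. -/
noncomputable def flip (p : ℝ) : PMF Bool :=
  PMF.ofFintype (fun b => if b then min 1 (ENNReal.ofReal p) else 1 - min 1 (ENNReal.ofReal p))
    (by simp)

/-- A uniformly random element of `{0, …, m - 1}` (`0` if `m = 0`). -/
noncomputable def uniformBelow (m : ℕ) : PMF ℕ :=
  PMF.uniformOfFinset (Finset.range (max m 1)) ⟨0, by simp⟩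

/-- Runs `f 0`, …, `f (m - 1)` one after the other, adding up the steps, and one further step for
each round. -/
noncomputable def iterate (f : ℕ → State → PMF (State × ℕ)) : ℕ → State → PMF (State × ℕ)
  | 0, σ => PMF.pure (σ, 0)
  | m + 1, σ => (iterate f m σ).bind fun o => (f m o.1).map fun o' => (o'.1, o.2 + o'.2 + 1)

/-- The joint law of the final state and of the number of steps, when a program is started in a
given state; every random choice is independent of the earlier ones. -/
noncomputable def Cmd.run {n : ℕ} {G : SimpleGraph (Fin n)} (L : AdjList G) :
    Cmd → State → PMF (State × ℕ)
  | .skip, σ => PMF.pure (σ, 1)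
  | .assign x e, σ => PMF.pure (σ.setReg x (e.eval σ), e.cost n + 1)
  | .write A i j e, σ => PMF.pure (σ.setMem A (i.eval σ) (j.eval σ) (e.eval σ),
      i.cost n + j.cost n + e.cost n + accessCost n)
  | .degree x v, σ => PMF.pure (σ.setReg x (L.deg (v.eval σ)), v.cost n + 1)
  | .neighbor x v i, σ => PMF.pure (σ.setReg x (L.nbr (v.eval σ) (i.eval σ)),
      v.cost n + i.cost n + 1)
  | .coin x p, σ => (flip p).map fun b => (σ.setReg x (if b then 1 else 0), 1)
  | .random x e, σ => (uniformBelow (e.eval σ)).map fun k => (σ.setReg x k, e.cost n + 1)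
  | .seq c c', σ => (Cmd.run L c σ).bind fun o =>
      (Cmd.run L c' o.1).map fun o' => (o'.1, o.2 + o'.2)
  | .ite p c c', σ => (if p.eval σ then Cmd.run L c σ else Cmd.run L c' σ).map fun o =>
      (o.1, o.2 + p.cost n + 1)
  | .loop x e c, σ => (iterate (fun i τ => Cmd.run L c (τ.setReg x i)) (e.eval σ) σ).map fun o =>
      (o.1, o.2 + e.cost n + 1)

/-! ## The construction -/

/-- The label of the cluster of the vertex `e`. -/
def clusterOf (e : Expr) : Expr := .read .cluster e (.const 0)

/-- Records the edge `{e, f}`. -/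
def recordEdge (e f : Expr) : Cmd :=
  .seq (.write .recorded e f (.const 1)) (.write .recorded f e (.const 1))

/-- Step 1: independently with probability `p`, every vertex becomes the centre of a new cluster. -/
def chooseCenters (p : ℝ) : Cmd :=
  .loop .v (.reg .n) <|
    .seq (.coin .b p) <|
    .ite (.eq (.reg .b) (.const 1))
      (.write .cluster (.reg .v) (.const 0) (.add (.reg .v) (.const 1)))
      .skip

/-- Step 2: every centre `v`, in turn, takes its unclustered neighbours `w` into its cluster, and
the edges `{v, w}` are recorded. -/
def assignClusters : Cmd :=
  .loop .v (.reg .n) <|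
    .ite (.eq (clusterOf (.reg .v)) (.add (.reg .v) (.const 1)))
      (.seq (.degree .d (.reg .v)) <|
        .loop .i (.reg .d) <|
          .seq (.neighbor .w (.reg .v) (.reg .i)) <|
          .ite (.eq (clusterOf (.reg .w)) (.const 0))
            (.seq (.write .cluster (.reg .w) (.const 0) (.add (.reg .v) (.const 1)))
              (recordEdge (.reg .v) (.reg .w)))
            .skip)
      .skip

/-- `x := 1 +` the index that currently stands at position `e` of the shuffled array of neighbours
of `v`; positions that have not been touched still hold their own index. -/
def lookup (x : Reg) (e : Expr) : Cmd :=
  .seq (.assign x (.read .shuffle (.reg .v) e)) <|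
  .ite (.eq (.reg x) (.const 0)) (.assign x (.add e (.const 1))) .skip

/-- `w :=` the `i`-th uniform sample without replacement from the neighbours of `v`, where `d` is
the degree of `v` and `i < d` (one round of the Fisher-Yates shuffle). -/
def sampleNeighbor : Cmd :=
  .seq (.random .j (.sub (.reg .d) (.reg .i))) <|
  .seq (.assign .j (.add (.reg .i) (.reg .j))) <|
  .seq (lookup .a (.reg .i)) <|
  .seq (lookup .b (.reg .j)) <|
  .seq (.write .shuffle (.reg .v) (.reg .j) (.reg .a)) <|
  .neighbor .w (.reg .v) (.sub (.reg .b) (.const 1))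

/-- Step 3: every vertex `v` samples `k` of its incident edges without replacement (all of them, if
there are fewer). For a sample `{v, w}` with `w` in another cluster than `v`, to which no edge from
`v` has been recorded yet, `v` is recorded as adjacent to that cluster, and the edge is recorded. -/
def sampleEdges (k : ℕ) : Cmd :=
  .loop .v (.reg .n) <|
    .seq (.degree .d (.reg .v)) <|
    .seq (.ite (.lt (.reg .d) (.const k)) (.assign .m (.reg .d)) (.assign .m (.const k))) <|
    .loop .i (.reg .m) <|
      .seq sampleNeighbor <|
      .ite (.and (.not (.eq (clusterOf (.reg .v)) (clusterOf (.reg .w))))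
            (.eq (.read .meets (.reg .v) (clusterOf (.reg .w))) (.const 0)))
        (.seq (.write .meets (.reg .v) (clusterOf (.reg .w)) (.const 1))
          (recordEdge (.reg .v) (.reg .w)))
        .skip

open Classical in
/-- The preprocessing algorithm with parameters `C`, `D`, `r` on `n`-vertex graphs. -/
noncomputable def preprocess (n : ℕ) (C D r : ℝ) : Cmd :=
  if D ≤ (n : ℝ) ^ (1 / 2 : ℝ) then
    .write .keepAll (.const 0) (.const 0) (.const 1)
  else
    .seq (chooseCenters (100 * C * Real.log n / D)) <|
    .seq assignClusters <|
    sampleEdges ⌈100 * C * r * Real.log n⌉₊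

/-- The query algorithm, for the edge `{s, t}`. -/
def query : Test :=
  .or (.not (.eq (.read .keepAll (.const 0) (.const 0)) (.const 0))) <|
  .or (.not (.eq (.read .recorded (.reg .s) (.reg .t)) (.const 0))) <|
  .and (.not (.eq (clusterOf (.reg .s)) (clusterOf (.reg .t)))) <|
  .and (.eq (.read .meets (.reg .s) (clusterOf (.reg .t))) (.const 0))
    (.eq (.read .meets (.reg .t) (clusterOf (.reg .s))) (.const 0))

/-- The answer to the query `(s, t)` from the memory left by the preprocessing. -/
def answer (σ : State) (s t : ℕ) : Bool :=
  query.eval ((σ.setReg .s s).setReg .t t)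

/-- In the memory `σ`, the query algorithm is an adjacency oracle for the edge-subgraph `H` of `G`:
it says whether an edge of `G` belongs to `H`, in at most `q` steps. -/
def IsAdjacencyOracle {n : ℕ} (σ : State) (G H : SimpleGraph (Fin n)) (q : ℝ) : Prop :=
  H ≤ G ∧ (∀ s t : Fin n, G.Adj s t → (answer σ s t = true ↔ H.Adj s t)) ∧
    (query.cost n : ℝ) ≤ q

/-- The probability that the preprocessing takes at most `T` steps and leaves an adjacency oracle,
with at most `q` steps per query, for a `3`-spanner of `G` with at most `E` edges. -/
noncomputable def successProb {n : ℕ} {G : SimpleGraph (Fin n)} (L : AdjList G) (C D r : ℝ)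
    (E T q : ℝ) : ENNReal :=
  ((preprocess n C D r).run L (State.init n)).toOuterMeasure
    {o | (o.2 : ℝ) ≤ T ∧ ∃ H : SimpleGraph (Fin n),
      IsAdjacencyOracle o.1 G H q ∧ IsSpanner 3 G H ∧ (H.edgeSet.ncard : ℝ) ≤ E}

end SpannerOracle

/-! If `D ≤ √n`, all of `G` is kept: it has at most `nCD` edges, and `r ≤ CD ≤ C√n` gives `nCD ≤
C²n²/r`. Otherwise write `l = log n`, let `p` be the probability of becoming a centre, and consider
`(n+1)²` bad events, each of probability at most `n⁻⁵`: a given vertex has no centre among its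
neighbours, of which `p · deg ≥ 100l` are centres on average when `p ≤ 1` (`expect_no_center_le`);
there are at least `B ≈ 4pn` centres (`expect_two_pow_numCenters_le` and Markov's inequality); a
given vertex misses a given foreign cluster that contains at least `T ≈ D/r + 100l` of its
neighbours (`expect_sampleEdges_le`). For the last event, a cluster with `a` neighbours of a vertex
of degree `d`, if still unmet, has all `a` of them among the entries not yet drawn, so each draw
misses it with probability at most `1 - a/d ≤ exp(-a/d)`.

If nothing bad happens, every vertex is in a cluster. Two vertices of one cluster are at distance at
most 2 through the centre. If an edge is dropped because one end has met the cluster of the other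
end, the recorded edge into that cluster followed by such a path has length at most 3
(`Sampling.isSpanner`). The oracle keeps at most one edge per clustered vertex, one per pair
(vertex, cluster met), and fewer than `T` per pair (vertex, cluster not met);
`Sampling.ncard_edgeSet_le` bounds these by `O(nBT)`. As `B` is about `C n l / D` and `1/D ≤ C/r`,
this is `O(C² l² n²/r)`. The running time is governed by `nk` draws with `k ≈ 100Crl`, and by `B`
scans of adjacency lists of length at most `CD`.

The programs are analysed with two loop rules: invariants with step counts hold on the whole support
(`iterate_support`), and probabilities are bounded by potentials whose mean does not increase in any
round (`iterate_expect_le`). `expect_failure_le` combines the three kinds of events, and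
`le_successProb_of_lt` chooses the parameters. -/

namespace SpannerOracle
open scoped ENNReal

/-! ## Expectations of nonnegative functions -/

/-- The expectation of a nonnegative function. -/
noncomputable def expect {α : Type*} (p : PMF α) (f : α → ℝ≥0∞) : ℝ≥0∞ := ∑' a, p a * f a

section expect
variable {α β : Type*}

lemma expect_pure (a : α) (f : α → ℝ≥0∞) : expect (PMF.pure a) f = f a := by
  unfold expect
  rw [tsum_eq_single a]
  · simp
  · intro b hb; simp [hb]

lemma expect_bind (p : PMF α) (g : α → PMF β) (f : β → ℝ≥0∞) :
    expect (p.bind g) f = expect p fun a => expect (g a) f := by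
  simp only [expect, PMF.bind_apply, ← ENNReal.tsum_mul_right, ← ENNReal.tsum_mul_left]
  rw [ENNReal.tsum_comm]
  simp only [mul_assoc]

lemma expect_map (p : PMF α) (g : α → β) (f : β → ℝ≥0∞) :
    expect (p.map g) f = expect p fun a => f (g a) := by
  rw [PMF.map, expect_bind]
  simp only [Function.comp_apply, expect_pure]

lemma expect_mono {p : PMF α} {f g : α → ℝ≥0∞} (h : ∀ a ∈ p.support, f a ≤ g a) :
    expect p f ≤ expect p g := by
  refine ENNReal.tsum_le_tsum fun a => ?_
  by_cases ha : a ∈ p.support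
  · gcongr; exact h a ha
  · simp [(PMF.apply_eq_zero_iff p a).2 ha]

lemma expect_const (p : PMF α) (x : ℝ≥0∞) : expect p (fun _ => x) = x := by
  simp [expect, ENNReal.tsum_mul_right, PMF.tsum_coe]

lemma expect_le_of_forall {p : PMF α} {f : α → ℝ≥0∞} {x : ℝ≥0∞}
    (h : ∀ a ∈ p.support, f a ≤ x) : expect p f ≤ x :=
  (expect_mono h).trans (expect_const p x).le

lemma expect_add (p : PMF α) (f g : α → ℝ≥0∞) :
    expect p (fun a => f a + g a) = expect p f + expect p g := by
  simp only [expect, mul_add, ENNReal.tsum_add]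

lemma expect_mul_const (p : PMF α) (f : α → ℝ≥0∞) (x : ℝ≥0∞) :
    expect p (fun a => f a * x) = expect p f * x := by
  simp only [expect, ← mul_assoc, ENNReal.tsum_mul_right]

lemma expect_finset_sum {ι : Type*} (s : Finset ι) (p : PMF α) (f : ι → α → ℝ≥0∞) :
    expect p (fun a => ∑ i ∈ s, f i a) = ∑ i ∈ s, expect p (f i) := by
  classical
  induction s using Finset.induction_on with
  | empty => simp [expect]
  | insert i s hi ih => simp only [Finset.sum_insert hi, expect_add, ih]

open Classical in
lemma one_le_toOuterMeasure_add (p : PMF α) (s : Set α) :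
    1 ≤ p.toOuterMeasure s + expect p (fun a => if a ∈ s then 0 else 1) := by
  rw [PMF.toOuterMeasure_apply, expect, ← ENNReal.tsum_add, ← PMF.tsum_coe p]
  refine ENNReal.tsum_le_tsum fun a => ?_
  by_cases ha : a ∈ s <;> simp [ha]

lemma expect_flip (p : ℝ) (f : Bool → ℝ≥0∞) :
    expect (flip p) f =
      min 1 (ENNReal.ofReal p) * f true + (1 - min 1 (ENNReal.ofReal p)) * f false := by
  simp [expect, flip, tsum_fintype]

lemma expect_uniformBelow {m : ℕ} (hm : 0 < m) (f : ℕ → ℝ≥0∞) :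
    expect (uniformBelow m) f = (∑ k ∈ Finset.range m, f k) / m := by
  have h1 : max m 1 = m := by omega
  rw [expect, tsum_eq_sum (s := Finset.range m)]
  · rw [div_eq_mul_inv, Finset.sum_mul]
    refine Finset.sum_congr rfl fun k hk => ?_
    have hk' : k < m := Finset.mem_range.1 hk
    simp [uniformBelow, PMF.uniformOfFinset_apply, hk', h1, mul_comm]
  · intro k hk
    have hk' : ¬ k < m := by simpa using hk
    simp [uniformBelow, PMF.uniformOfFinset_apply, h1, hk']

lemma mem_support_uniformBelow {m k : ℕ} (hm : 0 < m) : k ∈ (uniformBelow m).support ↔ k < m := by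
  have h1 : max m 1 = m := by omega
  simp [uniformBelow, h1]

end expect

/-! ## Loops -/

/-- Hoare rule for loops with step counts. The bound `b i` includes the extra step that `iterate`
charges for each round. -/
lemma iterate_support {f : ℕ → State → PMF (State × ℕ)} {m : ℕ} (I : ℕ → State → Prop)
    (b : ℕ → ℕ) (h : ∀ i < m, ∀ σ, I i σ → ∀ o ∈ (f i σ).support, I (i + 1) o.1 ∧ o.2 + 1 ≤ b i)
    {σ : State} (hσ : I 0 σ) :
    ∀ o ∈ (iterate f m σ).support, I m o.1 ∧ o.2 ≤ ∑ i ∈ Finset.range m, b i := by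
  induction m with
  | zero =>
    intro o ho
    simp only [iterate, PMF.support_pure, Set.mem_singleton_iff] at ho
    subst ho; simpa using hσ
  | succ m ih =>
    intro o ho
    simp only [iterate, PMF.mem_support_bind_iff, PMF.mem_support_map_iff] at ho
    obtain ⟨o₁, ho₁, o₂, ho₂, rfl⟩ := ho
    obtain ⟨h1, h2⟩ := ih (fun i hi => h i (by omega)) o₁ ho₁
    obtain ⟨h3, h4⟩ := h m (by omega) o₁.1 h1 o₂ ho₂
    refine ⟨h3, ?_⟩
    rw [Finset.sum_range_succ]
    dsimp only
    omega

/-- Supermartingale rule: a potential whose conditional mean does not grow in any round ends with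
mean at most its initial value. With an indicator as the final potential, this bounds a probability.
-/
lemma iterate_expect_le {f : ℕ → State → PMF (State × ℕ)} {m : ℕ} (I : ℕ → State → Prop)
    (Φ : ℕ → State → ℝ≥0∞)
    (hI : ∀ i < m, ∀ σ, I i σ → ∀ o ∈ (f i σ).support, I (i + 1) o.1)
    (hΦ : ∀ i < m, ∀ σ, I i σ → expect (f i σ) (fun o => Φ (i + 1) o.1) ≤ Φ i σ)
    {σ : State} (hσ : I 0 σ) :
    expect (iterate f m σ) (fun o => Φ m o.1) ≤ Φ 0 σ := by
  -- The one-round bound is available only where `I` holds, so the invariant is carried through the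
  -- induction along with the mean.
  suffices H : (∀ o ∈ (iterate f m σ).support, I m o.1) ∧
      expect (iterate f m σ) (fun o => Φ m o.1) ≤ Φ 0 σ from H.2
  induction m with
  | zero => simp [iterate, expect_pure, hσ]
  | succ m ih =>
    obtain ⟨h1, h2⟩ := ih (fun i hi => hI i (by omega)) (fun i hi => hΦ i (by omega))
    constructor
    · intro o ho
      simp only [iterate, PMF.mem_support_bind_iff, PMF.mem_support_map_iff] at ho
      obtain ⟨o₁, ho₁, o₂, ho₂, rfl⟩ := ho
      exact hI m (by omega) _ (h1 _ ho₁) o₂ ho₂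
    · simp only [iterate, expect_bind, expect_map]
      exact (expect_mono fun o ho => hΦ m (by omega) _ (h1 o ho)).trans h2

section rules
variable {n : ℕ} {G : SimpleGraph (Fin n)} (L : AdjList G)

lemma loop_support {x : Reg} {e : Expr} {c : Cmd} (I : ℕ → State → Prop) (b : ℕ → ℕ) {σ : State}
    (h : ∀ i < e.eval σ, ∀ τ, I i τ → ∀ o ∈ (c.run L (τ.setReg x i)).support,
      I (i + 1) o.1 ∧ o.2 + 1 ≤ b i) (hσ : I 0 σ) :
    ∀ o ∈ ((Cmd.loop x e c).run L σ).support, I (e.eval σ) o.1 ∧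
      o.2 ≤ ∑ i ∈ Finset.range (e.eval σ), b i + (e.cost n + 1) := by
  intro o ho
  simp only [Cmd.run, PMF.mem_support_map_iff] at ho
  obtain ⟨o₁, ho₁, rfl⟩ := ho
  obtain ⟨h1, h2⟩ := iterate_support I b h hσ o₁ ho₁
  exact ⟨h1, by dsimp only; omega⟩

lemma loop_expect_le {x : Reg} {e : Expr} {c : Cmd} (I : ℕ → State → Prop)
    (Φ : ℕ → State → ℝ≥0∞) {σ : State}
    (hI : ∀ i < e.eval σ, ∀ τ, I i τ → ∀ o ∈ (c.run L (τ.setReg x i)).support, I (i + 1) o.1)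
    (hΦ : ∀ i < e.eval σ, ∀ τ, I i τ →
      expect (c.run L (τ.setReg x i)) (fun o => Φ (i + 1) o.1) ≤ Φ i τ)
    (hσ : I 0 σ) :
    expect ((Cmd.loop x e c).run L σ) (fun o => Φ (e.eval σ) o.1) ≤ Φ 0 σ := by
  simp only [Cmd.run, expect_map]
  exact iterate_expect_le I Φ hI hΦ hσ

lemma expect_seq (c c' : Cmd) (σ : State) (f : State × ℕ → ℝ≥0∞) :
    expect ((Cmd.seq c c').run L σ) f =
      expect (c.run L σ) fun o => expect (c'.run L o.1) fun o' => f (o'.1, o.2 + o'.2) := by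
  simp only [Cmd.run, expect_bind, expect_map]

end rules

/-! ## Access to states -/

namespace State

@[simp] lemma setReg_mem (σ : State) (x : Reg) (k : ℕ) : (σ.setReg x k).mem = σ.mem := rfl

@[simp] lemma setReg_reg (σ : State) (x y : Reg) (k : ℕ) :
    (σ.setReg x k).reg y = if y = x then k else σ.reg y := by
  simp [setReg, Function.update_apply]

@[simp] lemma setMem_reg (σ : State) (A : Dict) (i j k : ℕ) :
    (σ.setMem A i j k).reg = σ.reg := rfl

@[simp] lemma setMem_mem (σ : State) (A B : Dict) (i j k u w : ℕ) :
    (σ.setMem A i j k).mem B u w = if B = A ∧ u = i ∧ w = j then k else σ.mem B u w := by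
  simp only [setMem, Function.update_apply]
  by_cases hB : B = A
  · subst hB
    by_cases hu : u = i
    · subst hu; by_cases hw : w = j <;> simp [hw]
    · simp [hu]
  · simp [hB]

end State

/-! ## Neighbours as numbers -/

/-- Adjacency of vertices that are given by their numbers. -/
def NatAdj {n : ℕ} (G : SimpleGraph (Fin n)) (u w : ℕ) : Prop :=
  ∃ (hu : u < n) (hw : w < n), G.Adj ⟨u, hu⟩ ⟨w, hw⟩

section NatAdj
variable {n : ℕ} {G : SimpleGraph (Fin n)}

lemma NatAdj.symm {u w : ℕ} (h : NatAdj G u w) : NatAdj G w u :=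
  let ⟨hu, hw, h⟩ := h; ⟨hw, hu, h.symm⟩

lemma NatAdj.ne {u w : ℕ} (h : NatAdj G u w) : u ≠ w := by
  obtain ⟨hu, hw, h⟩ := h
  rintro rfl
  exact G.loopless.irrefl _ h

lemma NatAdj.lt_right {u w : ℕ} (h : NatAdj G u w) : w < n := h.2.1

lemma natAdj_coe {s t : Fin n} : NatAdj G s t ↔ G.Adj s t :=
  ⟨fun ⟨_, _, h⟩ => h, fun h => ⟨s.2, t.2, h⟩⟩

variable (L : AdjList G)

lemma AdjList.nbr_adj {v i : ℕ} (hi : i < L.deg v) : NatAdj G v (L.nbr v i) := by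
  unfold AdjList.deg at hi
  split_ifs at hi with hv
  · have hm : (L.nbrs ⟨v, hv⟩)[i] ∈ L.nbrs ⟨v, hv⟩ := List.getElem_mem hi
    rw [L.mem_iff] at hm
    have : L.nbr v i = (L.nbrs ⟨v, hv⟩)[i] := by
      simp [AdjList.nbr, hv, List.getD_eq_getElem?_getD, hi]
    rw [this]
    exact ⟨hv, Fin.is_lt _, hm⟩
  · omega

lemma AdjList.exists_nbr {v w : ℕ} (h : NatAdj G v w) : ∃ i < L.deg v, L.nbr v i = w := by
  obtain ⟨hv, hw, h⟩ := h
  rw [← L.mem_iff, List.mem_iff_getElem] at h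
  obtain ⟨i, hi, h⟩ := h
  refine ⟨i, by simpa [AdjList.deg, hv] using hi, ?_⟩
  simp [AdjList.nbr, hv, List.getD_eq_getElem?_getD, hi, h]

lemma AdjList.deg_eq [DecidableRel G.Adj] (v : Fin n) : L.deg v = G.degree v := by
  have : (L.nbrs v).toFinset = G.neighborFinset v := by
    ext w; simp [L.mem_iff]
  rw [← SimpleGraph.card_neighborFinset_eq_degree, ← this,
    List.toFinset_card_of_nodup (L.nodup v)]
  simp [AdjList.deg]

end NatAdj

/-! ## The choice of the centres -/

/-- The memory after `i` rounds of the choice of the centres. -/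
structure CentersChosen (n i : ℕ) (σ : State) : Prop where
  reg_n : σ.reg .n = n
  cluster : ∀ u, σ.mem .cluster u 0 = 0 ∨ (u < i ∧ σ.mem .cluster u 0 = u + 1)
  other : ∀ A u w, A ≠ .cluster → σ.mem A u w = 0

lemma centersChosen_init (n : ℕ) : CentersChosen n 0 (State.init n) :=
  ⟨by simp [State.init], by simp [State.init], by simp [State.init]⟩

/-- One round of the choice of the centres. -/
def chooseCenter (p : ℝ) : Cmd :=
  .seq (.coin .b p) <|
  .ite (.eq (.reg .b) (.const 1))
    (.write .cluster (.reg .v) (.const 0) (.add (.reg .v) (.const 1)))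
    .skip

/-- The state after a round of the choice of the centres in which the coin shows `b`. -/
def centerState (σ : State) (i : ℕ) (b : Bool) : State :=
  if b then ((σ.setReg .v i).setReg .b 1).setMem .cluster i 0 (i + 1)
  else (σ.setReg .v i).setReg .b 0

section
variable {n : ℕ} {G : SimpleGraph (Fin n)} (L : AdjList G) (p : ℝ)

lemma chooseCenter_run (σ : State) (i : ℕ) : (chooseCenter p).run L (σ.setReg .v i) =
    (flip p).map fun b => (centerState σ i b, if b then accessCost n + 10 else 6) := by
  simp only [chooseCenter, Cmd.run, PMF.map, PMF.bind_bind, PMF.pure_bind, Function.comp_apply]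
  congr 1
  funext b
  cases b
  · simp [centerState, Test.eval, Expr.eval, Test.cost, Expr.cost, PMF.pure_bind]
  · simp [centerState, Test.eval, Expr.eval, Test.cost, Expr.cost, PMF.pure_bind]
    congr 2
    omega

lemma CentersChosen.step {n i : ℕ} {σ : State} (h : CentersChosen n i σ) (b : Bool) :
    CentersChosen n (i + 1) (centerState σ i b) := by
  cases b
  · refine ⟨by simp [centerState, h.reg_n], fun u => ?_, fun A u w hA => ?_⟩
    · have := h.cluster u
      simp only [centerState, Bool.false_eq_true, if_false, State.setReg_mem]
      omega
    · simp [centerState, h.other A u w hA]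
  · refine ⟨by simp [centerState, h.reg_n], fun u => ?_, fun A u w hA => ?_⟩
    · have := h.cluster u
      simp only [centerState, if_true, State.setReg_mem, State.setMem_mem, true_and, and_true]
      split_ifs <;> omega
    · simp [centerState, h.other A u w hA, hA]

lemma chooseCenter_support {i : ℕ} {σ : State} (h : CentersChosen n i σ) :
    ∀ o ∈ ((chooseCenter p).run L (σ.setReg .v i)).support,
      CentersChosen n (i + 1) o.1 ∧ o.2 + 1 ≤ accessCost n + 11 := by
  intro o ho
  simp only [chooseCenter_run, PMF.mem_support_map_iff] at ho
  obtain ⟨b, -, rfl⟩ := ho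
  exact ⟨h.step b, by cases b <;> simp⟩

lemma chooseCenters_support : ∀ o ∈ ((chooseCenters p).run L (State.init n)).support,
    CentersChosen n n o.1 ∧ o.2 ≤ n * (accessCost n + 11) + 2 := by
  intro o ho
  have := loop_support L (fun i σ => CentersChosen n i σ) (fun _ => accessCost n + 11)
    (fun i _ τ hτ => chooseCenter_support L p hτ) (centersChosen_init n) o ho
  simpa [Expr.eval, Expr.cost, State.init] using this

/-- The supermartingale rule for step 1, where the mean of a round is the average over the two
outcomes of its coin. -/
lemma expect_chooseCenters_le (Φ : ℕ → State → ℝ≥0∞)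
    (hΦ : ∀ i < n, ∀ σ, CentersChosen n i σ → min 1 (ENNReal.ofReal p) *
      Φ (i + 1) (centerState σ i true) + (1 - min 1 (ENNReal.ofReal p)) *
      Φ (i + 1) (centerState σ i false) ≤ Φ i σ) :
    expect ((chooseCenters p).run L (State.init n)) (fun o => Φ n o.1) ≤
      Φ 0 (State.init n) := by
  have hn : (Expr.reg Reg.n).eval (State.init n) = n := by simp [Expr.eval, State.init]
  have := loop_expect_le L (x := .v) (e := .reg .n) (c := chooseCenter p)
    (σ := State.init n) (CentersChosen n) Φ
    (fun i _ τ hτ o ho => (chooseCenter_support L p hτ o ho).1)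
    (fun i hi τ hτ => by
      rw [chooseCenter_run, expect_map, expect_flip]
      exact hΦ i (by omega) τ hτ)
    (centersChosen_init n)
  rwa [hn] at this

/-- The probability that no vertex of `N` becomes a centre. -/
lemma expect_no_center_le (N : Finset ℕ) (hN : ∀ u ∈ N, u < n) :
    expect ((chooseCenters p).run L (State.init n))
      (fun o => if ∀ u ∈ N, o.1.mem .cluster u 0 = 0 then 1 else 0) ≤
      (1 - min 1 (ENNReal.ofReal p)) ^ N.card := by
  classical
  set P := min 1 (ENNReal.ofReal p) with hP
  have hP1 : P + (1 - P) = 1 := add_tsub_cancel_of_le (min_le_left _ _)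
  -- Potential: the indicator that `N` contains no centre so far, times the probability that the
  -- members of `N` still to come all fail.
  have := expect_chooseCenters_le L p (fun i σ =>
    (if ∀ u ∈ N, σ.mem .cluster u 0 = 0 then 1 else 0) * (1 - P) ^ (N.filter (i ≤ ·)).card) ?_
  · have h1 : N.filter (n ≤ ·) = ∅ := by
      rw [Finset.filter_eq_empty_iff]
      intro u hu; have := hN u hu; omega
    simpa [h1, State.init] using this
  · intro i hi σ hσ
    rw [← hP]
    have hfalse : ∀ u, (centerState σ i false).mem .cluster u 0 = σ.mem .cluster u 0 := by
      simp [centerState]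
    have htrue : ∀ u, (centerState σ i true).mem .cluster u 0 =
        if u = i then i + 1 else σ.mem .cluster u 0 := by
      simp [centerState]
    by_cases hiN : i ∈ N
    · have h0 : ¬ ∀ u ∈ N, (centerState σ i true).mem .cluster u 0 = 0 := by
        intro h
        have := h i hiN
        simp [htrue] at this
      have hc : (N.filter (i ≤ ·)).card = (N.filter (i + 1 ≤ ·)).card + 1 := by
        rw [← Finset.card_insert_of_notMem (a := i) (by simp)]
        congr 1
        ext u
        simp only [Finset.mem_filter, Finset.mem_insert]
        constructor
        · rintro ⟨h1, h2⟩
          rcases h2.eq_or_lt with h | h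
          · exact Or.inl h.symm
          · exact Or.inr ⟨h1, h⟩
        · rintro (rfl | ⟨h1, h2⟩)
          · exact ⟨hiN, le_rfl⟩
          · exact ⟨h1, by omega⟩
      simp only [hfalse, h0, if_false, zero_mul, mul_zero, zero_add, hc, pow_succ]
      rw [mul_comm (1 - P), mul_assoc]
    · have hc : N.filter (i ≤ ·) = N.filter (i + 1 ≤ ·) := by
        refine Finset.filter_congr fun u hu => ?_
        have : u ≠ i := fun h => hiN (h ▸ hu)
        omega
      have h0 : (∀ u ∈ N, (centerState σ i true).mem .cluster u 0 = 0) ↔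
          ∀ u ∈ N, σ.mem .cluster u 0 = 0 := by
        refine forall₂_congr fun u hu => ?_
        have : u ≠ i := fun h => hiN (h ▸ hu)
        simp [htrue, this]
      simp only [hfalse, h0, hc]
      rw [← add_mul, hP1, one_mul]

/-- The number of centres. -/
def numCenters (n : ℕ) (σ : State) : ℕ :=
  ((Finset.range n).filter fun u => σ.mem .cluster u 0 ≠ 0).card

/-- An exponential moment of the number of centres: each coin contributes a factor of mean at most
`2P + (1 - P) = 1 + P`. Markov's inequality turns this into a tail bound. -/
lemma expect_two_pow_numCenters_le :
    expect ((chooseCenters p).run L (State.init n)) (fun o => 2 ^ numCenters n o.1) ≤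
      (1 + min 1 (ENNReal.ofReal p)) ^ n := by
  set P := min 1 (ENNReal.ofReal p) with hP
  have hP1 : P + (1 - P) = 1 := add_tsub_cancel_of_le (min_le_left _ _)
  have := expect_chooseCenters_le L p (fun i σ => 2 ^ numCenters n σ * (1 + P) ^ (n - i)) ?_
  · simpa [numCenters, State.init] using this
  · intro i hi σ hσ
    rw [← hP]
    have hfalse : numCenters n (centerState σ i false) = numCenters n σ := by
      simp [numCenters, centerState]
    have htrue : numCenters n (centerState σ i true) ≤ numCenters n σ + 1 := by
      unfold numCenters
      refine (Finset.card_le_card (t := insert i _) ?_).trans (Finset.card_insert_le i _)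
      intro u hu
      simp only [centerState, if_true, Finset.mem_filter, State.setMem_mem, true_and, and_true,
        State.setReg_mem, Finset.mem_insert] at hu ⊢
      by_cases h : u = i
      · exact Or.inl h
      · simp only [h, if_false] at hu; exact Or.inr hu
    have hn : n - i = (n - (i + 1)) + 1 := by omega
    calc _ ≤ P * (2 ^ (numCenters n σ + 1) * (1 + P) ^ (n - (i + 1))) +
          (1 - P) * (2 ^ numCenters n σ * (1 + P) ^ (n - (i + 1))) := by
            rw [hfalse]
            gcongr
            norm_num
      _ = 2 ^ numCenters n σ * (1 + P) ^ (n - (i + 1)) * (P + (P + (1 - P))) := by ring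
      _ = _ := by rw [hP1, hn, pow_succ]; ring

end

/-! ## The clusters -/

/-- The memory while the clusters are built, for the set `S` of centres. -/
structure Clustering {n : ℕ} (G : SimpleGraph (Fin n)) (S : Set ℕ) (σ : State) : Prop where
  reg_n : σ.reg .n = n
  other : ∀ A u w, A ≠ .cluster → A ≠ .recorded → σ.mem A u w = 0
  center : ∀ c ∈ S, σ.mem .cluster c 0 = c + 1
  cases : ∀ u, σ.mem .cluster u 0 = 0 ∨ u ∈ S ∨ ∃ c ∈ S, σ.mem .cluster u 0 = c + 1 ∧
    NatAdj G c u ∧ σ.mem .recorded c u ≠ 0 ∧ σ.mem .recorded u c ≠ 0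
  recorded : ∀ u w, σ.mem .recorded u w ≠ 0 → NatAdj G u w ∧
    (σ.mem .cluster w 0 = u + 1 ∨ σ.mem .cluster u 0 = w + 1)

/-- The centres found in the memory. -/
def centers (n : ℕ) (σ : State) : Set ℕ := {u | u < n ∧ σ.mem .cluster u 0 ≠ 0}

section
variable {n : ℕ} {G : SimpleGraph (Fin n)} (L : AdjList G) {S : Set ℕ}

lemma CentersChosen.clustering {σ : State} (h : CentersChosen n n σ) :
    Clustering G (centers n σ) σ where
  reg_n := h.reg_n
  other A u w hA _ := h.other A u w hA
  center c hc := ((h.cluster c).resolve_left hc.2).2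
  cases u := by
    by_cases hu : σ.mem .cluster u 0 = 0
    · exact Or.inl hu
    · exact Or.inr (Or.inl ⟨((h.cluster u).resolve_left hu).1, hu⟩)
  recorded u w hr := absurd (h.other .recorded u w (by decide)) hr

/-- A vertex outside `S` is unclustered or carries the label of an adjacent centre, which differs
from itself. Hence the program's test for being a centre stays correct while the clusters grow. -/
lemma Clustering.mem_iff {σ : State} (h : Clustering G S σ) (c : ℕ) :
    σ.mem .cluster c 0 = c + 1 ↔ c ∈ S := by
  refine ⟨fun hc => ?_, h.center c⟩
  rcases h.cases c with h0 | h0 | ⟨c', -, h1, h2, -⟩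
  · omega
  · exact h0
  · exact absurd (by omega) h2.ne

lemma Clustering.setReg {σ : State} (h : Clustering G S σ) {x : Reg} (hx : x ≠ .n) (k : ℕ) :
    Clustering G S (σ.setReg x k) :=
  ⟨by simp [hx.symm, h.reg_n], h.other, h.center, h.cases, h.recorded⟩

/-- The state after the centre `v` has taken its neighbour `w` into its cluster. -/
def takeState (σ : State) (v w : ℕ) : State :=
  if σ.mem .cluster w 0 = 0 then
    ((σ.setMem .cluster w 0 (v + 1)).setMem .recorded v w 1).setMem .recorded w v 1
  else σ

@[simp] lemma takeState_reg (σ : State) (v w : ℕ) : (takeState σ v w).reg = σ.reg := by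
  unfold takeState; split_ifs <;> simp

lemma takeState_cluster (σ : State) (v w u : ℕ) : (takeState σ v w).mem .cluster u 0 =
    if σ.mem .cluster w 0 = 0 ∧ u = w then v + 1 else σ.mem .cluster u 0 := by
  unfold takeState
  split_ifs <;> simp_all

lemma takeState_recorded (σ : State) (v w u z : ℕ) : (takeState σ v w).mem .recorded u z =
    if σ.mem .cluster w 0 = 0 ∧ ((u = v ∧ z = w) ∨ (u = w ∧ z = v)) then 1
    else σ.mem .recorded u z := by
  unfold takeState
  by_cases h : σ.mem .cluster w 0 = 0 <;> simp [h]
  grind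

/-- Only an unclustered vertex is ever relabelled, so centres and vertices already taken keep their
labels. -/
lemma Clustering.takeState {σ : State} (h : Clustering G S σ) {v w : ℕ} (hv : v ∈ S)
    (hvw : NatAdj G v w) : Clustering G S (takeState σ v w) where
  reg_n := by simp [h.reg_n]
  other A u z hA hA' := by
    unfold SpannerOracle.takeState
    split_ifs
    · simp [hA, hA', h.other A u z hA hA']
    · exact h.other A u z hA hA'
  center c hc := by
    have := h.center c hc
    rw [takeState_cluster]
    split_ifs with h1
    · rw [h1.2, h1.1] at this; omega
    · exact this
  cases u := by
    simp only [takeState_cluster, takeState_recorded]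
    by_cases h1 : σ.mem .cluster w 0 = 0 ∧ u = w
    · obtain ⟨h1, rfl⟩ := h1
      exact Or.inr (Or.inr ⟨v, hv, by simp [h1], hvw, by simp [h1], by simp [h1]⟩)
    · rw [if_neg h1]
      rcases h.cases u with h0 | h0 | ⟨c, hc, h2, h3, h4, h5⟩
      · exact Or.inl h0
      · exact Or.inr (Or.inl h0)
      · refine Or.inr (Or.inr ⟨c, hc, h2, h3, ?_, ?_⟩) <;> split_ifs <;> simp [h4, h5]
  recorded u z hr := by
    rw [takeState_recorded] at hr
    simp only [takeState_cluster]
    split_ifs at hr with h1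
    · obtain ⟨h1, ⟨rfl, rfl⟩ | ⟨rfl, rfl⟩⟩ := h1
      · exact ⟨hvw, by simp [h1]⟩
      · exact ⟨hvw.symm, by simp [h1]⟩
    · obtain ⟨h2, h3⟩ := h.recorded u z hr
      refine ⟨h2, ?_⟩
      rcases h3 with h3 | h3
      · left; rw [if_neg]; exact h3
        rintro ⟨h4, rfl⟩; omega
      · right; rw [if_neg]; exact h3
        rintro ⟨h4, rfl⟩; omega

lemma takeState_cluster_ne_zero {σ : State} {v w u : ℕ} (h : σ.mem .cluster u 0 ≠ 0) :
    (takeState σ v w).mem .cluster u 0 ≠ 0 := by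
  rw [takeState_cluster]; split_ifs <;> simp [h]

/-- A centre takes a neighbour into its cluster. -/
def takeNeighbor : Cmd :=
  .seq (.neighbor .w (.reg .v) (.reg .i)) <|
  .ite (.eq (clusterOf (.reg .w)) (.const 0))
    (.seq (.write .cluster (.reg .w) (.const 0) (.add (.reg .v) (.const 1)))
      (recordEdge (.reg .v) (.reg .w)))
    .skip

lemma takeNeighbor_support (σ : State) (j : ℕ) :
    ∀ o ∈ (takeNeighbor.run L (σ.setReg .i j)).support,
      o.1 = takeState ((σ.setReg .i j).setReg .w (L.nbr (σ.reg .v) j)) (σ.reg .v)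
        (L.nbr (σ.reg .v) j) ∧ o.2 + 1 ≤ 4 * accessCost n + 20 := by
  intro o ho
  by_cases h : σ.mem .cluster (L.nbr (σ.reg .v) j) 0 = 0
  · simp [takeNeighbor, recordEdge, clusterOf, Cmd.run, Expr.eval, Expr.cost, Test.eval, Test.cost,
      h, PMF.pure_bind, PMF.pure_map] at ho
    subst ho
    simp only [takeState, State.setReg_mem, h, if_true, true_and]
    omega
  · simp [takeNeighbor, recordEdge, clusterOf, Cmd.run, Expr.eval, Expr.cost, Test.eval, Test.cost,
      h, PMF.pure_bind, PMF.pure_map] at ho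
    subst ho
    simp only [takeState, State.setReg_mem, h, if_false, true_and]
    omega

/-- The round of a vertex in the construction of the clusters. -/
def assignCluster : Cmd :=
  .ite (.eq (clusterOf (.reg .v)) (.add (.reg .v) (.const 1)))
    (.seq (.degree .d (.reg .v)) (.loop .i (.reg .d) takeNeighbor))
    .skip

/-- The neighbours of the centres before `i` are clustered. -/
def Dominated (G : SimpleGraph (Fin n)) (S : Set ℕ) (i : ℕ) (σ : State) : Prop :=
  ∀ c ∈ S, c < i → ∀ w, NatAdj G c w → σ.mem .cluster w 0 ≠ 0

-- Only a centre pays for a scan of its adjacency list, so the rounds together cost `numCenters · Δ`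
-- scanning steps instead of `n · Δ`.
open Classical in
lemma assignCluster_support {Δ : ℕ} (hΔ : ∀ v, L.deg v ≤ Δ) {i : ℕ} {σ : State}
    (h : Clustering G S σ) (hd : Dominated G S i σ) :
    ∀ o ∈ (assignCluster.run L (σ.setReg .v i)).support,
      (Clustering G S o.1 ∧ Dominated G S (i + 1) o.1) ∧
        o.2 + 1 ≤ accessCost n + 12 + if i ∈ S then Δ * (4 * accessCost n + 20) else 0 := by
  intro o ho
  have hev : (Test.eq (clusterOf (.reg .v)) (.add (.reg .v) (.const 1))).eval (σ.setReg .v i) =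
      decide (i ∈ S) := by
    simp [Test.eval, clusterOf, Expr.eval, h.mem_iff]
  by_cases hi : i ∈ S
  · simp only [assignCluster, Cmd.run, hev, hi, decide_true, if_true, PMF.pure_bind,
      PMF.mem_support_map_iff] at ho
    obtain ⟨o₁, ⟨o₂, ⟨o₃, ho₃, rfl⟩, rfl⟩, rfl⟩ := ho
    have := iterate_support (m := L.deg i)
      -- After `j` rounds of the scan, the first `j` neighbours of the centre `i` are clustered, by
      -- it or by an earlier centre.
      (fun j τ => (Clustering G S τ ∧ Dominated G S i τ) ∧ τ.reg .v = i ∧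
        ∀ j' < j, τ.mem .cluster (L.nbr i j') 0 ≠ 0)
      (fun _ => 4 * accessCost n + 20) (f := fun j τ => takeNeighbor.run L (τ.setReg .i j))
      (fun j hj τ hτ o ho => by
        obtain ⟨⟨hτ1, hτ2⟩, hτ3, hτ4⟩ := hτ
        obtain ⟨ho1, ho2⟩ := takeNeighbor_support L τ j o ho
        refine ⟨?_, ho2⟩
        rw [ho1, hτ3]
        refine ⟨⟨?_, ?_⟩, by simp [hτ3], ?_⟩
        · exact ((hτ1.setReg (by decide) _).setReg (by decide) _).takeState hi (L.nbr_adj hj)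
        · intro c hc hci w hw
          exact takeState_cluster_ne_zero (hτ2 c hc hci w hw)
        · intro j' hj'
          rcases Nat.lt_succ_iff_lt_or_eq.1 hj' with h1 | rfl
          · exact takeState_cluster_ne_zero (hτ4 j' h1)
          · rw [takeState_cluster]
            split_ifs with h1
            · simp
            · simpa using h1)
      (σ := (σ.setReg .v i).setReg .d (L.deg i))
      ⟨⟨(h.setReg (by decide) _).setReg (by decide) _, hd⟩, by simp, by simp⟩
    have hE : (Expr.reg Reg.d).eval ((σ.setReg .v i).setReg .d
        (L.deg ((Expr.reg Reg.v).eval (σ.setReg .v i)))) = L.deg i := by simp [Expr.eval]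
    have hV : (Expr.reg Reg.v).eval (σ.setReg .v i) = i := by simp [Expr.eval]
    rw [hE, hV] at ho₃
    obtain ⟨⟨⟨h1, h2⟩, h3, h4⟩, h5⟩ := this o₃ ho₃
    refine ⟨⟨h1, fun c hc hci w hw => ?_⟩, ?_⟩
    · rcases Nat.lt_succ_iff_lt_or_eq.1 hci with h6 | rfl
      · exact h2 c hc h6 w hw
      · obtain ⟨j, hj, rfl⟩ := L.exists_nbr hw
        exact h4 j hj
    · have h6 : L.deg i * (4 * accessCost n + 20) ≤ Δ * (4 * accessCost n + 20) :=
        Nat.mul_le_mul_right _ (hΔ i)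
      simp only [Finset.sum_const, Finset.card_range, smul_eq_mul] at h5
      simp only [Expr.cost, Test.cost, clusterOf, hi, if_true]
      omega
  · simp only [assignCluster, Cmd.run, hev, hi, decide_false, Bool.false_eq_true, if_false,
      PMF.pure_map, PMF.support_pure, Set.mem_singleton_iff] at ho
    subst ho
    refine ⟨⟨h.setReg (by decide) _, fun c hc hci w hw => ?_⟩, ?_⟩
    · have : c ≠ i := fun h => hi (h ▸ hc)
      exact hd c hc (by omega) w hw
    · simp only [Expr.cost, Test.cost, clusterOf, hi, if_false]
      omega

lemma assignClusters_support {Δ : ℕ} (hΔ : ∀ v, L.deg v ≤ Δ) {σ : State}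
    (h : CentersChosen n n σ) :
    ∀ o ∈ (assignClusters.run L σ).support,
      Clustering G (centers n σ) o.1 ∧ Dominated G (centers n σ) n o.1 ∧
        o.2 ≤ n * (accessCost n + 12) + numCenters n σ * (Δ * (4 * accessCost n + 20)) + 2 := by
  classical
  intro o ho
  have := loop_support L (x := .v) (e := .reg .n) (c := assignCluster)
    (fun i τ => Clustering G (centers n σ) τ ∧ Dominated G (centers n σ) i τ) _
    (fun i _ τ hτ => assignCluster_support L hΔ hτ.1 hτ.2)
    ⟨h.clustering, fun c _ hc => by omega⟩ o ho
  have hn : (Expr.reg Reg.n).eval σ = n := h.reg_n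
  rw [hn] at this
  refine ⟨this.1.1, this.1.2, this.2.trans (le_of_eq ?_)⟩
  have hf : (Finset.range n).filter (· ∈ centers n σ) =
      (Finset.range n).filter fun u => σ.mem .cluster u 0 ≠ 0 :=
    Finset.filter_congr fun u hu => by simp [centers, Finset.mem_range.1 hu]
  rw [Finset.sum_add_distrib, ← Finset.sum_filter, hf]
  simp [numCenters, Expr.cost]

end

/-! ## The samples -/

/-- The index at position `l` of the shuffled array of neighbours of `v`. -/
def slot (σ : State) (v l : ℕ) : ℕ :=
  if σ.mem .shuffle v l = 0 then l else σ.mem .shuffle v l - 1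

/-- The state after the sample `{v, w}` has been examined. -/
def meetState (σ : State) (v w : ℕ) : State :=
  if σ.mem .cluster v 0 ≠ σ.mem .cluster w 0 ∧ σ.mem .meets v (σ.mem .cluster w 0) = 0 then
    ((σ.setMem .meets v (σ.mem .cluster w 0) 1).setMem .recorded v w 1).setMem .recorded w v 1
  else σ

/-- The examination of one sample. -/
def examine : Cmd :=
  .ite (.and (.not (.eq (clusterOf (.reg .v)) (clusterOf (.reg .w))))
        (.eq (.read .meets (.reg .v) (clusterOf (.reg .w))) (.const 0)))
    (.seq (.write .meets (.reg .v) (clusterOf (.reg .w)) (.const 1))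
      (recordEdge (.reg .v) (.reg .w)))
    .skip

/-- The drawing and the examination of one sample. -/
def drawEdge : Cmd := .seq sampleNeighbor examine

/-- The round of a vertex in the sampling of edges. -/
def sampleVertex (k : ℕ) : Cmd :=
  .seq (.degree .d (.reg .v)) <|
  .seq (.ite (.lt (.reg .d) (.const k)) (.assign .m (.reg .d)) (.assign .m (.const k))) <|
  .loop .i (.reg .m) drawEdge

/-! ### Execution of one round of the sampling. -/

section
variable {n : ℕ} {G : SimpleGraph (Fin n)} (L : AdjList G)

/-- The register `y` may be read again after `x` has been overwritten, which is why the two must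
differ. -/
lemma lookup_run {x y : Reg} (hxy : y ≠ x) (σ : State) :
    ∃ τ c, (lookup x (.reg y)).run L σ = PMF.pure (τ, c) ∧ τ.mem = σ.mem ∧
      (∀ z, z ≠ x → τ.reg z = σ.reg z) ∧ τ.reg x = slot σ (σ.reg .v) (σ.reg y) + 1 ∧
      c ≤ accessCost n + 11 := by
  by_cases h : σ.mem .shuffle (σ.reg .v) (σ.reg y) = 0
  · refine ⟨?τ, ?c, ?_, ?_⟩
    rotate_left 2
    · simp only [lookup, Cmd.run, PMF.pure_bind, PMF.pure_map, Test.eval, Expr.eval,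
        State.setReg_reg, if_true, h, decide_true]
      rfl
    · refine ⟨rfl, fun z hz => by simp [hz], by simp [hxy, slot, h], ?_⟩
      simp only [Expr.cost, Test.cost]; omega
  · refine ⟨?τ', ?c', ?_, ?_⟩
    rotate_left 2
    · simp only [lookup, Cmd.run, PMF.pure_bind, PMF.pure_map, Test.eval, Expr.eval,
        State.setReg_reg, if_true, h, decide_false, Bool.false_eq_true, if_false]
      rfl
    · refine ⟨rfl, fun z hz => by simp [hz], by simp [slot, h]; omega, ?_⟩
      simp only [Expr.cost, Test.cost]; omega

lemma examine_run (σ : State) :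
    ∃ c, examine.run L σ =
      PMF.pure (meetState σ (σ.reg .v) (σ.reg .w), c) ∧ c ≤ 8 * accessCost n + 30 := by
  by_cases h : σ.mem .cluster (σ.reg .v) 0 ≠ σ.mem .cluster (σ.reg .w) 0 ∧
      σ.mem .meets (σ.reg .v) (σ.mem .cluster (σ.reg .w) 0) = 0
  · refine ⟨?c, ?_, ?_⟩
    rotate_left
    · simp only [examine, recordEdge, clusterOf, Cmd.run, PMF.pure_bind, PMF.pure_map, Test.eval, Expr.eval,
        meetState, h, decide_true, decide_false, Bool.not_false, Bool.and_self, if_true,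
        State.setMem_reg, and_self, ne_eq, not_false_eq_true]
      rfl
    · simp only [Expr.cost, Test.cost]; omega
  · refine ⟨?c', ?_, ?_⟩
    rotate_left
    · simp only [examine, recordEdge, clusterOf, Cmd.run, PMF.pure_bind, PMF.pure_map, Test.eval,
        Expr.eval, meetState, h, if_false]
      rw [if_neg (by
        simp only [Bool.and_eq_true, Bool.not_eq_true']
        exact fun h' => h ⟨of_decide_eq_false h'.1, of_decide_eq_true h'.2⟩), PMF.pure_map]
    · simp only [Expr.cost, Test.cost]; omega

/-- The relation between the states before and after round `i` of the shuffle for the vertex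
`σ.reg .v`, if the random number drawn is `k`. -/
def Drawn (L : AdjList G) (σ : State) (i k : ℕ) (σ' : State) : Prop :=
  ∃ τ : State, τ.mem = σ.mem ∧ τ.reg .v = σ.reg .v ∧ τ.reg .d = σ.reg .d ∧
    τ.reg .n = σ.reg .n ∧
    σ' = meetState (τ.setMem .shuffle (σ.reg .v) (i + k) (slot σ (σ.reg .v) i + 1)) (σ.reg .v)
      (L.nbr (σ.reg .v) (slot σ (σ.reg .v) (i + k)))

/-- Once the random number is drawn, the rest of the round is deterministic; the law of the round is
therefore the image of a uniform law. -/
lemma drawEdge_run (σ : State) (i : ℕ) :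
    ∃ g : ℕ → State × ℕ,
      drawEdge.run L (σ.setReg .i i) = (uniformBelow (σ.reg .d - i)).map g ∧
      ∀ k, Drawn L σ i k (g k).1 ∧ (g k).2 + 1 ≤ 11 * accessCost n + 80 := by
  suffices H : ∀ k, ∃ o : State × ℕ, (Cmd.seq (.seq (.assign .j (.add (.reg .i) (.reg .j))) <|
      .seq (lookup .a (.reg .i)) <| .seq (lookup .b (.reg .j)) <|
      .seq (.write .shuffle (.reg .v) (.reg .j) (.reg .a)) <|
      .neighbor .w (.reg .v) (.sub (.reg .b) (.const 1)))
      examine).run L ((σ.setReg .i i).setReg .j k) =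
        PMF.pure o ∧ Drawn L σ i k o.1 ∧ o.2 + 5 ≤ 11 * accessCost n + 80 by
    choose g hg using H
    -- The 4 steps are those of the random draw, which `H` leaves out.
    refine ⟨fun k => ((g k).1, (g k).2 + 4), ?_, fun k => ⟨(hg k).2.1, by
      have := (hg k).2.2; dsimp only; omega⟩⟩
    have hd : (Expr.sub (.reg .d) (.reg .i)).eval (σ.setReg .i i) = σ.reg .d - i := by
      simp [Expr.eval]
    have hc : (Expr.sub (.reg .d) (.reg .i)).cost n + 1 = 4 := by simp [Expr.cost]
    rw [drawEdge, sampleNeighbor, Cmd.run, Cmd.run, Cmd.run, hd, hc]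
    simp only [PMF.map, PMF.bind_bind, PMF.pure_bind, Function.comp_def]
    congr 1
    funext k
    have h := (hg k).1
    rw [Cmd.run] at h
    have h' := congrArg (PMF.map fun o : State × ℕ => (o.1, o.2 + 4)) h
    rw [PMF.pure_map] at h'
    rw [← h']
    simp only [PMF.map, PMF.bind_bind, PMF.pure_bind, Function.comp_def]
    congr 1
    funext o
    congr 1
    funext o'
    congr 2
    omega
  intro k
  set σ₁ := ((σ.setReg .i i).setReg .j k).setReg .j (i + k) with hσ₁
  obtain ⟨σ₂, c₂, hr₂, hm₂, hz₂, hx₂, hc₂⟩ := lookup_run L (x := .a) (y := .i) (by decide) σ₁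
  obtain ⟨σ₃, c₃, hr₃, hm₃, hz₃, hx₃, hc₃⟩ := lookup_run L (x := .b) (y := .j) (by decide) σ₂
  have hm₁ : σ₁.mem = σ.mem := rfl
  have hslot : ∀ τ : State, τ.mem = σ.mem → slot τ = slot σ := fun τ h => by
    funext v l; simp [slot, h]
  have hv : σ₃.reg .v = σ.reg .v := by
    rw [hz₃ _ (by decide), hz₂ _ (by decide)]; simp [hσ₁]
  have hj : σ₃.reg .j = i + k := by
    rw [hz₃ _ (by decide), hz₂ _ (by decide)]; simp [hσ₁]
  have ha : σ₃.reg .a = slot σ (σ.reg .v) i + 1 := by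
    rw [hz₃ _ (by decide), hx₂, hslot _ hm₁]; simp [hσ₁]
  have hb : σ₃.reg .b = slot σ (σ.reg .v) (i + k) + 1 := by
    rw [hx₃, hslot _ (hm₂.trans hm₁), hz₂ _ (by decide), hz₂ _ (by decide)]; simp [hσ₁]
  set σ₄ := σ₃.setMem .shuffle (σ.reg .v) (i + k) (slot σ (σ.reg .v) i + 1) with hσ₄
  set w := L.nbr (σ.reg .v) (slot σ (σ.reg .v) (i + k)) with hw
  obtain ⟨c₅, hr₅, hc₅⟩ := examine_run L (σ₄.setReg .w w)
  have e1 : (Expr.add (.reg .i) (.reg .j)).eval ((σ.setReg .i i).setReg .j k) = i + k := by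
    simp [Expr.eval]
  refine ⟨?o, ?_, ?_⟩
  rotate_left
  · rw [Cmd.run, Cmd.run, Cmd.run, e1]
    simp only [Cmd.run, ← hσ₁, PMF.pure_bind, PMF.pure_map, hr₂, hr₃, Expr.eval, hv, hj, ha, hb,
      State.setMem_reg, Nat.add_sub_cancel]
    simp only [← hσ₄, ← hw, hr₅, PMF.pure_map]
    rfl
  · refine ⟨⟨σ₃.setReg .w w, by simp [hm₃, hm₂, hm₁], by simp [hv], ?_, ?_, ?_⟩, ?_⟩
    · simp only [State.setReg_reg, reduceCtorEq, if_false]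
      rw [hz₃ _ (by decide), hz₂ _ (by decide)]; simp [hσ₁]
    · simp only [State.setReg_reg, reduceCtorEq, if_false]
      rw [hz₃ _ (by decide), hz₂ _ (by decide)]; simp [hσ₁]
    · have : (σ₄.setReg .w w).reg .v = σ.reg .v := by simp [hσ₄, hv]
      simp only [this]
      simp only [State.setReg_reg, if_true]
      rfl
    · simp only [Expr.cost]; omega

lemma sampleVertex_run (k : ℕ) (σ : State) (v : ℕ) :
    ∃ τ : State, τ.mem = σ.mem ∧ τ.reg .v = v ∧ τ.reg .d = L.deg v ∧ τ.reg .n = σ.reg .n ∧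
      (sampleVertex k).run L (σ.setReg .v v) =
        (iterate (fun i τ => drawEdge.run L (τ.setReg .i i)) (min (L.deg v) k) τ).map
          fun o => (o.1, o.2 + 10) := by
  by_cases h : L.deg v < k
  · refine ⟨((σ.setReg .v v).setReg .d (L.deg v)).setReg .m (L.deg v), ?_, ?_, ?_, ?_, ?_⟩
    rotate_left 4
    · simp only [sampleVertex, Cmd.run, PMF.pure_bind, PMF.pure_map, Test.eval, Expr.eval,
        State.setReg_reg, if_true, h, decide_true, PMF.map_comp, min_eq_left h.le,
        Expr.cost, Test.cost]
      congr 1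
      funext o
      simp only [Function.comp_apply, Prod.mk.injEq, true_and]
      omega
    all_goals simp
  · refine ⟨((σ.setReg .v v).setReg .d (L.deg v)).setReg .m k, ?_, ?_, ?_, ?_, ?_⟩
    rotate_left 4
    · simp only [sampleVertex, Cmd.run, PMF.pure_bind, PMF.pure_map, Test.eval, Expr.eval,
        State.setReg_reg, if_true, h, decide_false, Bool.false_eq_true, if_false, PMF.map_comp,
        min_eq_right (not_lt.1 h), Expr.cost, Test.cost]
      congr 1
      funext o
      simp only [Function.comp_apply, Prod.mk.injEq, true_and]
      omega
    all_goals simp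

end

/-! ### Effect of an examined sample on the memory, and the invariant of the recorded edges. -/

lemma meetState_reg (σ : State) (v w : ℕ) : (meetState σ v w).reg = σ.reg := by
  unfold meetState; split_ifs <;> simp

lemma meetState_mem (σ : State) (v w : ℕ) {A : Dict} (h : A ≠ .meets) (h' : A ≠ .recorded)
    (u z : ℕ) : (meetState σ v w).mem A u z = σ.mem A u z := by
  unfold meetState; split_ifs <;> simp [h, h']

/-- `v` becomes adjacent to the cluster of `w` when the sample `{v, w}` is examined. -/
def Meets (σ : State) (v w : ℕ) : Prop :=
  σ.mem .cluster v 0 ≠ σ.mem .cluster w 0 ∧ σ.mem .meets v (σ.mem .cluster w 0) = 0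

lemma meetState_of_meets {σ : State} {v w : ℕ} (h : Meets σ v w) : meetState σ v w =
    ((σ.setMem .meets v (σ.mem .cluster w 0) 1).setMem .recorded v w 1).setMem .recorded w v 1 :=
  if_pos h

lemma meetState_of_not_meets {σ : State} {v w : ℕ} (h : ¬ Meets σ v w) : meetState σ v w = σ :=
  if_neg h

open Classical in
lemma meetState_meets (σ : State) (v w u x : ℕ) : (meetState σ v w).mem .meets u x =
    if Meets σ v w ∧ u = v ∧ x = σ.mem .cluster w 0 then 1 else σ.mem .meets u x := by
  by_cases h : Meets σ v w
  · rw [meetState_of_meets h]; simp [h]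
  · rw [meetState_of_not_meets h]; simp [h]

open Classical in
lemma meetState_recorded (σ : State) (v w u z : ℕ) : (meetState σ v w).mem .recorded u z =
    if Meets σ v w ∧ ((u = v ∧ z = w) ∨ (u = w ∧ z = v)) then 1
    else σ.mem .recorded u z := by
  by_cases h : Meets σ v w
  · rw [meetState_of_meets h]; simp [h]; grind
  · rw [meetState_of_not_meets h]; simp [h]

/-- The memory while edges are sampled. The clusters are given by `cl`, the edges recorded before
by `P`, and `R` is the set of the edges recorded since then, oriented away from the vertex for which
they were recorded. -/
structure Sampling {n : ℕ} (G : SimpleGraph (Fin n)) (cl : ℕ → ℕ) (P : ℕ → ℕ → Prop)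
    (R : Set (ℕ × ℕ)) (σ : State) : Prop where
  reg_n : σ.reg .n = n
  cluster : ∀ u, σ.mem .cluster u 0 = cl u
  keepAll : σ.mem .keepAll 0 0 = 0
  recorded : ∀ u w, σ.mem .recorded u w ≠ 0 ↔ P u w ∨ (u, w) ∈ R ∨ (w, u) ∈ R
  adj : ∀ u w, (u, w) ∈ R → NatAdj G u w
  inj : ∀ u w w', (u, w) ∈ R → (u, w') ∈ R → cl w = cl w' → w = w'
  meets : ∀ u x, σ.mem .meets u x ≠ 0 ↔ ∃ w, (u, w) ∈ R ∧ cl w = x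

section
variable {n : ℕ} {G : SimpleGraph (Fin n)} {cl : ℕ → ℕ} {P : ℕ → ℕ → Prop} {R : Set (ℕ × ℕ)}

/-- The dictionary `shuffle` is scratch space that the invariant does not see. -/
lemma Sampling.congr {σ τ : State} (h : Sampling G cl P R σ) (hn : τ.reg .n = σ.reg .n)
    (hm : ∀ A, A ≠ .shuffle → ∀ u w, τ.mem A u w = σ.mem A u w) : Sampling G cl P R τ where
  reg_n := hn.trans h.reg_n
  cluster u := by rw [hm _ (by decide)]; exact h.cluster u
  keepAll := by rw [hm _ (by decide)]; exact h.keepAll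
  recorded u w := by rw [hm _ (by decide)]; exact h.recorded u w
  adj := h.adj
  inj := h.inj
  meets u x := by rw [hm _ (by decide)]; exact h.meets u x

lemma Sampling.meetState {σ : State} (h : Sampling G cl P R σ) {v w : ℕ} (hvw : NatAdj G v w) :
    ∃ R, Sampling G cl P R (meetState σ v w) := by
  classical
  by_cases hM : Meets σ v w
  · refine ⟨insert (v, w) R, by rw [meetState_reg, h.reg_n], fun u => ?_, ?_, fun u z => ?_,
      fun u z => ?_, fun u z z' => ?_, fun u x => ?_⟩
    · rw [meetState_mem _ _ _ (by decide) (by decide), h.cluster]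
    · rw [meetState_mem _ _ _ (by decide) (by decide), h.keepAll]
    · rw [meetState_recorded]
      simp only [hM, true_and, Set.mem_insert_iff, Prod.mk.injEq]
      have := h.recorded u z
      split_ifs with h1
      · rcases h1 with ⟨rfl, rfl⟩ | ⟨rfl, rfl⟩ <;> simp
      · rw [this]; tauto
    · rintro (h1 | h1)
      · cases h1; exact hvw
      · exact h.adj u z h1
    -- An earlier edge of `R` from `v` into the cluster of `w` would have set the `meets` entry that
    -- was just found to be 0.
    · have h0 : ∀ y, (v, y) ∈ R → cl y ≠ cl w := fun y hy hc => by
        have := (h.meets v (cl w)).2 ⟨y, hy, hc⟩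
        exact this (by rw [← h.cluster]; exact hM.2)
      rintro (h1 | h1) (h2 | h2) hc
      · cases h1; cases h2; rfl
      · cases h1; exact absurd hc.symm (h0 _ h2)
      · cases h2; exact absurd hc (h0 _ h1)
      · exact h.inj u z z' h1 h2 hc
    · rw [meetState_meets, h.cluster]
      simp only [hM, true_and]
      split_ifs with h1
      · obtain ⟨rfl, rfl⟩ := h1
        simp only [ne_eq, one_ne_zero, not_false_eq_true, true_iff]
        exact ⟨w, Or.inl rfl, rfl⟩
      · rw [h.meets]
        constructor
        · rintro ⟨y, hy, hc⟩; exact ⟨y, Or.inr hy, hc⟩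
        · rintro ⟨y, hy | hy, hc⟩
          · cases hy; exact absurd ⟨rfl, hc.symm⟩ h1
          · exact ⟨y, hy, hc⟩
  · refine ⟨R, ?_⟩
    rwa [meetState_of_not_meets hM]

/-! ### The shuffle, and the probability that a cluster is missed. -/

variable (L : AdjList G)

/-- The state before round `i` of the shuffle for the vertex `v`. -/
structure Shuffling (L : AdjList G) (cl : ℕ → ℕ) (P : ℕ → ℕ → Prop) (v i : ℕ) (σ : State) :
    Prop where
  sampling : ∃ R, Sampling G cl P R σ
  reg_v : σ.reg .v = v
  reg_d : σ.reg .d = L.deg v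
  slot_lt : ∀ l, i ≤ l → l < L.deg v → slot σ v l < L.deg v
  fresh : ∀ u, v < u → ∀ l, σ.mem .shuffle u l = 0

/-- The neighbours of `v` in the cluster `x` that can still be sampled in round `i` or later
are all of them, unless `v` has met this cluster. -/
def Covers (L : AdjList G) (cl : ℕ → ℕ) (v x i : ℕ) (σ : State) : Prop :=
  σ.mem .meets v x = 0 → ∀ g < L.deg v, cl (L.nbr v g) = x →
    ∃ l, i ≤ l ∧ l < L.deg v ∧ slot σ v l = g

variable {L} {v i k : ℕ} {σ σ' : State}

lemma Drawn.meets_ne_zero (h : Drawn L σ i k σ') {u x : ℕ} (hx : σ.mem .meets u x ≠ 0) :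
    σ'.mem .meets u x ≠ 0 := by
  classical
  obtain ⟨τ, h1, -, -, -, rfl⟩ := h
  rw [meetState_meets]
  split_ifs
  · simp
  · simpa [h1] using hx

/-- Only half of the Fisher-Yates swap is stored: position `i` is never looked up after its own
round, so its content need not be replaced. -/
lemma Shuffling.slot_drawn (h : Shuffling L cl P v i σ) (hd : Drawn L σ i k σ') (l : ℕ) :
    slot σ' v l = if l = i + k then slot σ v i else slot σ v l := by
  obtain ⟨τ, h1, h2, h3, h4, rfl⟩ := hd
  simp only [slot, meetState_mem _ _ _ (show Dict.shuffle ≠ .meets by decide)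
    (show Dict.shuffle ≠ .recorded by decide), State.setMem_mem, h1, h.reg_v, true_and]
  by_cases hl : l = i + k <;> simp [hl]

lemma Shuffling.drawn (h : Shuffling L cl P v i σ) (hd : Drawn L σ i k σ')
    (hk : k < L.deg v - i) : Shuffling L cl P v (i + 1) σ' := by
  have hs := h.slot_drawn hd
  obtain ⟨R, hR⟩ := h.sampling
  obtain ⟨τ, h1, h2, h3, h4, rfl⟩ := hd
  refine ⟨?_, by simp [meetState_reg, h2, h.reg_v], by simp [meetState_reg, h3, h.reg_d],
    fun l hl hl' => ?_, fun u hu l => ?_⟩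
  · refine Sampling.meetState (R := R) (hR.congr (by simp [h4]) fun A hA u w => ?_) ?_
    · simp [hA, h1]
    · rw [h.reg_v]
      exact L.nbr_adj (h.slot_lt _ (by omega) (by omega))
  · rw [hs]
    split_ifs
    · exact h.slot_lt _ le_rfl (by omega)
    · exact h.slot_lt _ (by omega) hl'
  · rw [meetState_mem _ _ _ (by decide) (by decide)]
    have : u ≠ v := by omega
    simp [h1, h.reg_v, this, h.fresh u hu l]

/-- If `v` had not met the cluster `x` before, examining a neighbour in it records the meeting;
otherwise the old entry persists. -/
lemma Shuffling.meets_drawn (h : Shuffling L cl P v i σ) (hd : Drawn L σ i k σ') {x : ℕ}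
    (hvx : cl v ≠ x) (hx : cl (L.nbr v (slot σ v (i + k))) = x) : σ'.mem .meets v x ≠ 0 := by
  classical
  by_cases h0 : σ.mem .meets v x = 0
  · obtain ⟨R, hR⟩ := h.sampling
    obtain ⟨τ, h1, h2, h3, h4, rfl⟩ := hd
    rw [meetState_meets, if_pos]
    · simp
    · subst hx
      simp only [Meets, State.setMem_mem, h1, h.reg_v, hR.cluster, h0, hvx, reduceCtorEq, false_and,
        if_false, ne_eq, not_false_eq_true, and_self]
  · exact hd.meets_ne_zero h0

lemma Shuffling.covers_drawn (h : Shuffling L cl P v i σ) (hd : Drawn L σ i k σ') {x : ℕ}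
    (hvx : cl v ≠ x) (hc : Covers L cl v x i σ) (hk : k < L.deg v - i) :
    Covers L cl v x (i + 1) σ' := by
  intro h0 g hg hgx
  have h0' : σ.mem .meets v x = 0 := by
    by_contra hne; exact hd.meets_ne_zero hne h0
  obtain ⟨l, hl, hl', hlg⟩ := hc h0' g hg hgx
  -- While the cluster is unmet, the entry drawn cannot belong to it. So `g` keeps its position,
  -- unless it stood at position `i` and is moved to `i + k`.
  have hlk : l ≠ i + k := by
    rintro rfl
    exact h.meets_drawn hd hvx (by rw [hlg, hgx]) h0
  by_cases hli : l = i
  · refine ⟨i + k, by omega, by omega, ?_⟩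
    rw [h.slot_drawn hd, if_pos rfl, ← hli, hlg]
  · refine ⟨l, by omega, hl', ?_⟩
    rw [h.slot_drawn hd, if_neg hlk, hlg]

open Classical in
/-- The number of neighbours of `v` in the cluster `x`. -/
noncomputable def clusterDeg (L : AdjList G) (cl : ℕ → ℕ) (v x : ℕ) : ℕ :=
  ((Finset.range (L.deg v)).filter fun g => cl (L.nbr v g) = x).card

lemma drawEdge_support (h : Shuffling L cl P v i σ) (hi : i < L.deg v) :
    ∀ o ∈ (drawEdge.run L (σ.setReg .i i)).support,
      (∃ k < L.deg v - i, Drawn L σ i k o.1) ∧ o.2 + 1 ≤ 11 * accessCost n + 80 := by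
  intro o ho
  obtain ⟨g, hg, hg'⟩ := drawEdge_run L σ i
  rw [hg, PMF.mem_support_map_iff] at ho
  obtain ⟨k, hk, rfl⟩ := ho
  rw [h.reg_d, mem_support_uniformBelow (by omega)] at hk
  exact ⟨⟨k, hk, (hg' k).1⟩, (hg' k).2⟩

/-- The probability that a cluster is missed in one round of the shuffle. -/
lemma expect_drawEdge_le (h : Shuffling L cl P v i σ) (hi : i < L.deg v) {x : ℕ}
    (hvx : cl v ≠ x) (hc : Covers L cl v x i σ) :
    expect (drawEdge.run L (σ.setReg .i i)) (fun o => if o.1.mem .meets v x = 0 then 1 else 0) ≤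
      (if σ.mem .meets v x = 0 then 1 else 0) *
        (((L.deg v - i - clusterDeg L cl v x : ℕ) : ℝ≥0∞) / (L.deg v - i : ℕ)) := by
  classical
  by_cases h0 : σ.mem .meets v x = 0
  · obtain ⟨g, hg, hg'⟩ := drawEdge_run L σ i
    rw [hg, expect_map, h.reg_d, expect_uniformBelow (by omega), if_pos h0, one_mul]
    gcongr
    have h1 : ∀ k, (if (g k).1.mem .meets v x = 0 then (1 : ℝ≥0∞) else 0) ≤
        if cl (L.nbr v (slot σ v (i + k))) ≠ x then 1 else 0 := fun k => by
      by_cases hx : cl (L.nbr v (slot σ v (i + k))) = x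
      · rw [if_neg (h.meets_drawn (hg' k).1 hvx hx)]; simp
      · rw [if_pos hx]; split_ifs <;> simp
    refine (Finset.sum_le_sum fun k _ => h1 k).trans ?_
    rw [Finset.sum_boole]
    norm_cast
    have h2 := Finset.card_filter_add_card_filter_not
      (s := Finset.range (L.deg v - i)) fun k => cl (L.nbr v (slot σ v (i + k))) = x
    rw [Finset.card_range] at h2
    -- By `Covers`, every neighbour in the cluster still stands at some position from `i` on, so at
    -- least `clusterDeg` of the possible draws hit the cluster.
    have h3 : clusterDeg L cl v x ≤ ((Finset.range (L.deg v - i)).filter fun k =>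
        cl (L.nbr v (slot σ v (i + k))) = x).card := by
      refine (Finset.card_le_card (t := Finset.image (fun k => slot σ v (i + k)) _) ?_).trans
        Finset.card_image_le
      intro g hg
      simp only [Finset.mem_filter, Finset.mem_range] at hg
      obtain ⟨l, hl, hl', rfl⟩ := hc h0 g hg.1 hg.2
      refine Finset.mem_image.2 ⟨l - i, ?_, by congr 1; omega⟩
      have : i + (l - i) = l := by omega
      simp only [Finset.mem_filter, Finset.mem_range, this]
      exact ⟨by omega, hg.2⟩
    omega
  · rw [if_neg h0, zero_mul]
    refine expect_le_of_forall fun o ho => ?_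
    obtain ⟨⟨k, -, hk⟩, -⟩ := drawEdge_support h hi o ho
    rw [if_neg (hk.meets_ne_zero h0)]

/-- The state before the round of the vertex `v` in the sampling of edges. -/
structure Resting (G : SimpleGraph (Fin n)) (cl : ℕ → ℕ) (P : ℕ → ℕ → Prop) (v : ℕ) (σ : State) :
    Prop where
  sampling : ∃ R, Sampling G cl P R σ
  fresh : ∀ u, v ≤ u → ∀ l, σ.mem .shuffle u l = 0

/-- Row `v` of `shuffle` is still empty, so each position holds its own index. -/
lemma Resting.shuffling (h : Resting G cl P v σ) {τ : State} (hm : τ.mem = σ.mem)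
    (hv : τ.reg .v = v) (hd : τ.reg .d = L.deg v) (hn : τ.reg .n = σ.reg .n) :
    Shuffling L cl P v 0 τ where
  sampling := by
    obtain ⟨R, hR⟩ := h.sampling
    exact ⟨R, hR.congr hn fun A _ u w => by rw [hm]⟩
  reg_v := hv
  reg_d := hd
  slot_lt l _ hl := by simpa [slot, hm, h.fresh v le_rfl] using hl
  fresh u hu l := by rw [hm]; exact h.fresh u hu.le l

variable (k)

lemma sampleVertex_support (h : Resting G cl P v σ) :
    ∀ o ∈ ((sampleVertex k).run L (σ.setReg .v v)).support,
      (Resting G cl P (v + 1) o.1 ∧ ∀ u x, σ.mem .meets u x ≠ 0 → o.1.mem .meets u x ≠ 0) ∧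
        o.2 + 1 ≤ k * (11 * accessCost n + 80) + 11 := by
  intro o ho
  obtain ⟨τ, hm, hv, hd, hn, hrun⟩ := sampleVertex_run L k σ v
  rw [hrun, PMF.mem_support_map_iff] at ho
  obtain ⟨o, ho, rfl⟩ := ho
  obtain ⟨⟨h1, h2⟩, h3⟩ := iterate_support
    (fun i τ => Shuffling L cl P v i τ ∧ ∀ u x, σ.mem .meets u x ≠ 0 → τ.mem .meets u x ≠ 0)
    (fun _ => 11 * accessCost n + 80)
    (fun i hi τ hτ o ho => by
      obtain ⟨⟨k', hk', hd'⟩, hc⟩ := drawEdge_support hτ.1 (lt_of_lt_of_le hi (min_le_left _ _)) o ho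
      exact ⟨⟨hτ.1.drawn hd' hk', fun u x hx => hd'.meets_ne_zero (hτ.2 u x hx)⟩, hc⟩)
    ⟨h.shuffling hm hv hd hn, fun u x hx => by rwa [hm]⟩ o ho
  refine ⟨⟨⟨h1.sampling, fun u hu l => h1.fresh u hu l⟩, h2⟩, ?_⟩
  simp only [Finset.sum_const, Finset.card_range, smul_eq_mul] at h3
  have : min (L.deg v) k * (11 * accessCost n + 80) ≤ k * (11 * accessCost n + 80) :=
    Nat.mul_le_mul_right _ (min_le_right _ _)
  dsimp only
  omega

/-- The probability that a cluster is missed by the samples of a vertex. -/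
lemma expect_sampleVertex_le (h : Resting G cl P v σ) {x : ℕ} (hvx : cl v ≠ x) {q : ℝ≥0∞}
    (hq : ∀ m : ℕ, 0 < m → m ≤ L.deg v → ((m - clusterDeg L cl v x : ℕ) : ℝ≥0∞) / m ≤ q) :
    expect ((sampleVertex k).run L (σ.setReg .v v))
      (fun o => if o.1.mem .meets v x = 0 then 1 else 0) ≤ q ^ min (L.deg v) k := by
  obtain ⟨τ, hm, hv, hd, hn, hrun⟩ := sampleVertex_run L k σ v
  rw [hrun, expect_map]
  have := iterate_expect_le (m := min (L.deg v) k) (σ := τ)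
    (fun i τ => Shuffling L cl P v i τ ∧ Covers L cl v x i τ)
    -- Potential: the indicator that the cluster is still unmet, times the bound for missing it in
    -- all remaining draws.
    (fun i τ => (if τ.mem .meets v x = 0 then 1 else 0) * q ^ (min (L.deg v) k - i))
    (f := fun i τ => drawEdge.run L (τ.setReg .i i))
    (fun i hi τ hτ o ho => by
      obtain ⟨⟨k', hk', hd'⟩, hc⟩ := drawEdge_support hτ.1 (lt_of_lt_of_le hi (min_le_left _ _)) o ho
      exact ⟨hτ.1.drawn hd' hk', hτ.1.covers_drawn hd' hvx hτ.2 hk'⟩)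
    (fun i hi τ hτ => by
      have hi' := lt_of_lt_of_le hi (min_le_left _ _)
      have hs : min (L.deg v) k - i = (min (L.deg v) k - (i + 1)) + 1 := by omega
      rw [expect_mul_const, hs, pow_succ', ← mul_assoc]
      gcongr
      refine (expect_drawEdge_le hτ.1 hi' hvx hτ.2).trans ?_
      gcongr
      exact hq _ (by omega) (by omega))
    ⟨h.shuffling hm hv hd hn, fun _ g hg _ => ⟨g, by omega, hg, by
      simp [slot, hm, h.fresh v le_rfl]⟩⟩
  simp only [Nat.sub_self, pow_zero, mul_one, Nat.sub_zero] at this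
  refine this.trans ?_
  split_ifs <;> simp

lemma sampleEdges_support (h : Resting G cl P 0 σ) :
    ∀ o ∈ ((sampleEdges k).run L σ).support,
      (∃ R, Sampling G cl P R o.1) ∧ o.2 ≤ n * (k * (11 * accessCost n + 80) + 11) + 2 := by
  intro o ho
  have hn : (Expr.reg Reg.n).eval σ = n := by
    obtain ⟨R, hR⟩ := h.sampling
    exact hR.reg_n
  have := loop_support L (x := .v) (e := .reg .n) (c := sampleVertex k) (Resting G cl P)
    (fun _ => k * (11 * accessCost n + 80) + 11)
    (fun i _ τ hτ o ho => by
      have := sampleVertex_support k hτ o ho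
      exact ⟨this.1.1, this.2⟩) h o ho
  rw [hn] at this
  exact ⟨this.1.sampling, by simpa [Expr.cost] using this.2⟩

/-- The probability that a cluster is missed by a vertex. -/
lemma expect_sampleEdges_le (h : Resting G cl P 0 σ) (hv : v < n) {x : ℕ} (hvx : cl v ≠ x)
    {q : ℝ≥0∞}
    (hq : ∀ m : ℕ, 0 < m → m ≤ L.deg v → ((m - clusterDeg L cl v x : ℕ) : ℝ≥0∞) / m ≤ q) :
    expect ((sampleEdges k).run L σ) (fun o => if o.1.mem .meets v x = 0 then 1 else 0) ≤
      q ^ min (L.deg v) k := by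
  have hn : (Expr.reg Reg.n).eval σ = n := by
    obtain ⟨R, hR⟩ := h.sampling
    exact hR.reg_n
  have := loop_expect_le L (x := .v) (e := .reg .n) (c := sampleVertex k) (σ := σ)
    (Resting G cl P)
    -- The potential is the constant bound until the round of `v`, and the indicator of a miss
    -- afterwards; later rounds cannot increase it, because entries of `meets` are never erased.
    (fun i τ => if i ≤ v then q ^ min (L.deg v) k else if τ.mem .meets v x = 0 then 1 else 0)
    (fun i _ τ hτ o ho => (sampleVertex_support k hτ o ho).1.1)
    (fun i _ τ hτ => by
      rcases lt_trichotomy i v with hi | rfl | hi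
      · rw [if_pos hi.le]
        refine expect_le_of_forall fun o _ => ?_
        rw [if_pos (by omega)]
      · rw [if_pos le_rfl]
        simp only [Nat.not_succ_le_self, if_false]
        exact expect_sampleVertex_le k hτ hvx hq
      · rw [if_neg (by omega)]
        refine expect_le_of_forall fun o ho => ?_
        rw [if_neg (by omega)]
        by_cases h0 : τ.mem .meets v x = 0
        · rw [if_pos h0]; split_ifs <;> simp
        · rw [if_neg ((sampleVertex_support k hτ o ho).1.2 v x h0), if_neg h0])
    h
  rw [hn] at this
  simp only [Nat.not_le.2 hv, if_false, Nat.zero_le, if_true] at this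
  exact this

end

/-! ## The oracle in a good memory -/

/-- Stretch need only be checked on edges: along a shortest walk of `G` the bounds add up by the
triangle inequality. -/
lemma isSpanner_of_adj {V : Type*} {G H : SimpleGraph V} {k : ℕ} (hk : 0 < k) (hle : H ≤ G)
    (h : ∀ s t, G.Adj s t → H.edist s t ≤ k) : IsSpanner k G H := by
  refine ⟨hle, fun s t => ?_⟩
  by_cases htop : G.edist s t = ⊤
  · rw [htop, ENat.mul_top (by exact_mod_cast hk.ne')]
    exact le_top
  · obtain ⟨p, hp⟩ := SimpleGraph.exists_walk_of_edist_ne_top htop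
    rw [← hp]
    clear hp htop
    induction p with
    | nil => simp
    | @cons u v w huv p ih =>
      calc H.edist u w ≤ H.edist u v + H.edist v w := SimpleGraph.edist_triangle
        _ ≤ k + k * p.length := add_le_add (h u v huv) ih
        _ = k * (p.length + 1 : ℕ) := by push_cast; ring
        _ = _ := by rw [SimpleGraph.Walk.length_cons]

lemma edist_le_one {V : Type*} {H : SimpleGraph V} {s t : V} (h : s = t ∨ H.Adj s t) :
    H.edist s t ≤ 1 := by
  rcases h with rfl | h
  · simp
  · exact (SimpleGraph.edist_eq_one_iff_adj.2 h).le

lemma answer_eq_true_iff {σ : State} (h : σ.mem .keepAll 0 0 = 0) (s t : ℕ) :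
    answer σ s t = true ↔ σ.mem .recorded s t ≠ 0 ∨
      (σ.mem .cluster s 0 ≠ σ.mem .cluster t 0 ∧ σ.mem .meets s (σ.mem .cluster t 0) = 0 ∧
        σ.mem .meets t (σ.mem .cluster s 0) = 0) := by
  simp [answer, query, Test.eval, Expr.eval, clusterOf, h]

section
variable {n : ℕ} {G : SimpleGraph (Fin n)} (L : AdjList G) {S : Set ℕ} {σ τ : State}

/-- The labels of the clusters. -/
abbrev State.label (σ : State) (u : ℕ) : ℕ := σ.mem .cluster u 0

/-- The edge `{u, w}` is recorded. -/
abbrev State.IsRecorded (σ : State) (u w : ℕ) : Prop := σ.mem .recorded u w ≠ 0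

lemma Clustering.exists_center (h : Clustering G S σ) {u : ℕ} (hu : σ.label u ≠ 0) :
    ∃ c ∈ S, σ.label u = c + 1 ∧ (u = c ∨ σ.IsRecorded u c) := by
  rcases h.cases u with h0 | h0 | ⟨c, hc, h1, h2, h3, h4⟩
  · exact absurd h0 hu
  · exact ⟨u, h0, h.center u h0, Or.inl rfl⟩
  · exact ⟨c, hc, h1, Or.inr h4⟩

/-- The label condition singles out the non-central end of a recorded edge, and for such a vertex
`cases` gives the edge to its centre in both orientations. -/
lemma Clustering.isRecorded_symm (h : Clustering G S σ) {u w : ℕ} (hr : σ.IsRecorded u w) :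
    σ.IsRecorded w u := by
  obtain ⟨ha, hr' | hr'⟩ := h.recorded u w hr
  · rcases h.cases w with h0 | h0 | ⟨c, hc, h1, h2, h3, h4⟩
    · omega
    · have := h.center w h0; exact absurd (by omega) ha.ne
    · have : c = u := by omega
      exact this ▸ h4
  · rcases h.cases u with h0 | h0 | ⟨c, hc, h1, h2, h3, h4⟩
    · omega
    · have := h.center u h0; exact absurd (by omega) ha.ne
    · have : c = w := by omega
      exact this ▸ h3

/-- The subgraph of the edges for which the oracle answers YES. -/
def answerGraph (G : SimpleGraph (Fin n)) (τ : State)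
    (h : ∀ s t : Fin n, answer τ s t = true → answer τ t s = true) : SimpleGraph (Fin n) where
  Adj s t := G.Adj s t ∧ answer τ s t = true
  symm := ⟨fun s t hst => ⟨hst.1.symm, h s t hst.2⟩⟩
  loopless := ⟨fun s hs => G.loopless.irrefl s hs.1⟩

variable {R : Set (ℕ × ℕ)} (hC : Clustering G S σ)
  (hS : Sampling G σ.label σ.IsRecorded R τ)
include hC hS

lemma Sampling.answer_symm {s t : ℕ} (h : answer τ s t = true) : answer τ t s = true := by
  rw [answer_eq_true_iff hS.keepAll] at h ⊢
  rw [hS.recorded] at h ⊢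
  rcases h with (h | h | h) | ⟨h1, h2, h3⟩
  · exact Or.inl (Or.inl (hC.isRecorded_symm h))
  · exact Or.inl (Or.inr (Or.inr h))
  · exact Or.inl (Or.inr (Or.inl h))
  · exact Or.inr ⟨h1.symm, h3, h2⟩

lemma Sampling.adj_of_recorded {s t : Fin n} (h : τ.IsRecorded s t) :
    (answerGraph G τ fun _ _ => hS.answer_symm hC).Adj s t := by
  refine ⟨?_, (answer_eq_true_iff hS.keepAll s t).2 (Or.inl h)⟩
  rw [← natAdj_coe]
  rcases (hS.recorded s t).1 h with h | h | h
  · exact (hC.recorded s t h).1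
  · exact hS.adj _ _ h
  · exact (hS.adj _ _ h).symm

/-- A vertex is within distance 1 of its centre, so clusters have diameter at most 2. A dropped edge
either lies inside a cluster, or one end has a recorded edge into the cluster of the other, which
gives `1 + 2`. -/
lemma Sampling.isSpanner (hn : ∀ c ∈ S, c < n) (hcl : ∀ v < n, σ.label v ≠ 0) :
    IsSpanner 3 G (answerGraph G τ fun _ _ => hS.answer_symm hC) := by
  set H := answerGraph G τ fun _ _ => hS.answer_symm hC with hH
  have hcenter : ∀ u : Fin n, ∃ c : Fin n, σ.label u = c + 1 ∧ H.edist u c ≤ 1 := fun u => by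
    obtain ⟨c, hc, h1, h2⟩ := hC.exists_center (hcl u u.2)
    refine ⟨⟨c, hn c hc⟩, h1, edist_le_one ?_⟩
    rcases h2 with h2 | h2
    · exact Or.inl (Fin.ext h2)
    · exact Or.inr (hS.adj_of_recorded hC ((hS.recorded _ _).2 (Or.inl h2)))
  have htwo : ∀ u w : Fin n, σ.label u = σ.label w → H.edist u w ≤ 2 := fun u w huw => by
    obtain ⟨c, hc, h1⟩ := hcenter u
    obtain ⟨c', hc', h2⟩ := hcenter w
    have : c' = c := Fin.ext (by omega)
    subst this
    calc H.edist u w ≤ H.edist u c' + H.edist c' w := SimpleGraph.edist_triangle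
      _ ≤ 1 + 1 := add_le_add h1 (by rwa [SimpleGraph.edist_comm])
      _ = 2 := by norm_num
  have hthree : ∀ s t : Fin n, τ.mem .meets s (σ.label t) ≠ 0 → H.edist s t ≤ 3 :=
    fun s t hst => by
      obtain ⟨w, hw, hwt⟩ := (hS.meets _ _).1 hst
      have hsw : H.Adj s ⟨w, (hS.adj _ _ hw).lt_right⟩ :=
        hS.adj_of_recorded hC ((hS.recorded _ _).2 (Or.inr (Or.inl hw)))
      calc H.edist s t ≤ _ := SimpleGraph.edist_triangle
        _ ≤ 1 + 2 := add_le_add (edist_le_one (Or.inr hsw)) (htwo _ t hwt)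
        _ = 3 := by norm_num
  refine isSpanner_of_adj (by norm_num) (fun s t (h : H.Adj s t) => h.1) fun s t hst => ?_
  by_cases ha : answer τ s t = true
  · exact (edist_le_one (Or.inr (show H.Adj s t from ⟨hst, ha⟩))).trans (by norm_num)
  · rw [answer_eq_true_iff hS.keepAll] at ha
    simp only [hS.cluster] at ha
    by_cases h1 : σ.label s = σ.label t
    · exact (htwo s t h1).trans (by norm_num)
    · by_cases h2 : τ.mem .meets s (σ.label t) = 0
      · by_cases h3 : τ.mem .meets t (σ.label s) = 0
        · exact absurd (Or.inr ⟨h1, h2, h3⟩) ha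
        · rw [SimpleGraph.edist_comm]
          exact_mod_cast hthree t s h3
      · exact_mod_cast hthree s t h2

/-- Each kept edge is charged to a vertex or to a pair (vertex, label), according to why the answer
is YES. A pair that was not met is charged by at most `T` edges, since `hT` leaves it fewer than `T`
candidates. -/
lemma Sampling.ncard_edgeSet_le (hcl : ∀ v < n, σ.label v ≠ 0) {N : Finset ℕ} (hN : ∀ c ∈ S, c ∈ N)
    {T : ℕ} (hT : ∀ v < n, ∀ x ≤ n, σ.label v ≠ x → T ≤ clusterDeg L σ.label v x →
      τ.mem .meets v x ≠ 0) (hn : ∀ c ∈ S, c < n) :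
    (answerGraph G τ fun _ _ => hS.answer_symm hC).edgeSet.ncard ≤
      2 * n + 2 * (n * N.card) + T * (n * N.card) := by
  classical
  set H := answerGraph G τ fun _ _ => hS.answer_symm hC with hH
  set Λ : Finset ℕ := N.image (· + 1) with hΛ
  have hΛc : Λ.card ≤ N.card := Finset.card_image_le
  have hlabel : ∀ u : Fin n, σ.label u ∈ Λ := fun u => by
    obtain ⟨c, hc, h1, -⟩ := hC.exists_center (hcl u u.2)
    exact Finset.mem_image.2 ⟨c, hN c hc, h1.symm⟩
  have hlabel' : ∀ u : Fin n, σ.label u ≤ n := fun u => by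
    obtain ⟨c, hc, h1, -⟩ := hC.exists_center (hcl u u.2)
    have := hn c hc
    omega
  have hprod : ((Finset.univ : Finset (Fin n)) ×ˢ Λ).card ≤ n * N.card := by
    rw [Finset.card_product, Finset.card_univ, Fintype.card_fin]
    exact Nat.mul_le_mul_left _ hΛc
  -- Ordered pairs by reason: edges of step 2 in both orientations, edges of step 3 in both
  -- orientations, and unrecorded edges between clusters that have not been met.
  let A₁ : Finset (Fin n × Fin n) := Finset.univ.filter fun p => σ.label p.2 = p.1 + 1
  let A₂ : Finset (Fin n × Fin n) := Finset.univ.filter fun p => σ.label p.1 = p.2 + 1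
  let A₃ : Finset (Fin n × Fin n) := Finset.univ.filter fun p => ((p.1 : ℕ), (p.2 : ℕ)) ∈ R
  let A₄ : Finset (Fin n × Fin n) := Finset.univ.filter fun p => ((p.2 : ℕ), (p.1 : ℕ)) ∈ R
  let A₅ : Finset (Fin n × Fin n) := Finset.univ.filter fun p => G.Adj p.1 p.2 ∧
    σ.label p.1 ≠ σ.label p.2 ∧ τ.mem .meets p.1 (σ.label p.2) = 0
  have h₁ : A₁.card ≤ n := by
    refine (Finset.card_le_card_of_injOn Prod.snd (t := Finset.univ) (by simp) ?_).trans (by simp)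
    rintro ⟨a, b⟩ hab ⟨a', b'⟩ hab' h
    simp only [A₁, Finset.coe_filter, Finset.mem_univ, true_and, Set.mem_ofPred_eq] at hab hab' h
    subst h
    exact Prod.ext (Fin.ext (by dsimp only; omega)) rfl
  have h₂ : A₂.card ≤ n := by
    refine (Finset.card_le_card_of_injOn Prod.fst (t := Finset.univ) (by simp) ?_).trans (by simp)
    rintro ⟨a, b⟩ hab ⟨a', b'⟩ hab' h
    simp only [A₂, Finset.coe_filter, Finset.mem_univ, true_and, Set.mem_ofPred_eq] at hab hab' h
    subst h
    exact Prod.ext rfl (Fin.ext (by dsimp only; omega))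
  have h₃ : A₃.card ≤ n * N.card := by
    refine (Finset.card_le_card_of_injOn (fun p => (p.1, σ.label p.2))
      (t := Finset.univ ×ˢ Λ) (fun p _ => by simp [hlabel]) ?_).trans hprod
    rintro ⟨a, b⟩ hab ⟨a', b'⟩ hab' h
    simp only [A₃, Finset.coe_filter, Finset.mem_univ, true_and, Set.mem_ofPred_eq] at hab hab'
    obtain ⟨rfl, h⟩ := Prod.mk.inj h
    exact Prod.ext rfl (Fin.ext (hS.inj _ _ _ hab hab' h))
  have h₄ : A₄.card ≤ n * N.card := by
    refine (Finset.card_le_card_of_injOn Prod.swap (t := A₃) ?_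
      Prod.swap_injective.injOn).trans h₃
    intro p hp
    simpa [A₃, A₄] using hp
  -- The fibre over `(v, x)` injects into the neighbours of `v` with label `x`; a single member of
  -- it shows that `v` has not met `x`, whence `hT` bounds their number.
  have h₅ : A₅.card ≤ T * (n * N.card) := by
    refine (Finset.card_le_mul_card_image_of_maps_to (f := fun p => (p.1, σ.label p.2))
      (t := Finset.univ ×ˢ Λ) (fun p _ => by simp [hlabel]) T ?_).trans
      (Nat.mul_le_mul_left _ hprod)
    rintro ⟨v, x⟩ -
    rcases Finset.eq_empty_or_nonempty (A₅.filter fun p => (p.1, σ.label p.2) = (v, x)) with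
      h0 | ⟨⟨v', w'⟩, hw'⟩
    · rw [h0]; simp
    · have hlt : clusterDeg L σ.label v x ≤ T := by
        simp only [A₅, Finset.mem_filter, Finset.mem_univ, true_and, Prod.mk.injEq] at hw'
        obtain ⟨⟨-, h1, h2⟩, rfl, rfl⟩ := hw'
        by_contra hlt
        exact hT _ v'.2 _ (hlabel' w') h1 (by omega) h2
      refine le_trans ?_ hlt
      refine (Finset.card_le_card_of_injOn (fun p => (p.2 : ℕ))
        (t := ((Finset.range (L.deg v)).filter fun g => σ.label (L.nbr v g) = x).image (L.nbr v))
        ?_ ?_).trans Finset.card_image_le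
      · rintro ⟨a, b⟩ hab
        simp only [A₅, Finset.coe_filter, Finset.mem_filter, Finset.mem_univ, true_and,
          Prod.mk.injEq, Set.mem_ofPred_eq] at hab
        obtain ⟨⟨h1, -⟩, rfl, rfl⟩ := hab
        obtain ⟨i, hi, hib⟩ := L.exists_nbr (natAdj_coe.2 h1)
        simp only [Finset.coe_image, Set.mem_image, Finset.coe_filter, Finset.mem_range,
          Set.mem_ofPred_eq]
        exact ⟨i, ⟨hi, by rw [hib]⟩, hib⟩
      · rintro ⟨a, b⟩ hab ⟨a', b'⟩ hab' h
        simp only [Finset.coe_filter, Prod.mk.injEq, Set.mem_ofPred_eq] at hab hab'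
        exact Prod.ext (hab.2.1.trans hab'.2.1.symm) (Fin.ext h)
  have hsub : H.edgeSet ⊆ (fun p : Fin n × Fin n => s(p.1, p.2)) ''
      (A₁ ∪ (A₂ ∪ (A₃ ∪ (A₄ ∪ A₅))) : Finset (Fin n × Fin n)) := by
    intro e
    induction e using Sym2.ind with
    | h s t =>
      intro hst
      refine ⟨(s, t), ?_, rfl⟩
      obtain ⟨hG, ha⟩ := SimpleGraph.mem_edgeSet _ |>.1 hst
      rw [answer_eq_true_iff hS.keepAll, hS.recorded] at ha
      simp only [hS.cluster] at ha
      simp only [Finset.coe_union, A₁, A₂, A₃, A₄, A₅, Finset.coe_filter, Finset.mem_univ,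
        true_and, Set.mem_union, Set.mem_ofPred_eq]
      rcases ha with (h | h | h) | ⟨h1, h2, h3⟩
      · rcases (hC.recorded s t h).2 with h | h <;> tauto
      · tauto
      · tauto
      · tauto
  refine (Set.ncard_le_ncard hsub (Set.toFinite _)).trans ((Set.ncard_image_le).trans ?_)
  rw [Set.ncard_coe_finset]
  have e1 := Finset.card_union_le A₁ (A₂ ∪ (A₃ ∪ (A₄ ∪ A₅)))
  have e2 := Finset.card_union_le A₂ (A₃ ∪ (A₄ ∪ A₅))
  have e3 := Finset.card_union_le A₃ (A₄ ∪ A₅)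
  have e4 := Finset.card_union_le A₄ A₅
  omega

end

/-! ## The probability of failure -/

section
variable {n : ℕ} {G : SimpleGraph (Fin n)} (L : AdjList G)

lemma Clustering.resting {S : Set ℕ} {σ : State} (h : Clustering G S σ) :
    Resting G σ.label σ.IsRecorded 0 σ where
  sampling := ⟨∅, h.reg_n, fun _ => rfl, h.other _ _ _ (by decide) (by decide),
    fun u w => by simp, by simp, by simp, fun u x => by
      simp [h.other .meets u x (by decide) (by decide)]⟩
  fresh u _ l := h.other .shuffle u l (by decide) (by decide)

/-- The numbers of the neighbours of `v`. -/
def natNeighbors [DecidableRel G.Adj] (v : Fin n) : Finset ℕ :=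
  (G.neighborFinset v).map Fin.valEmbedding

lemma mem_natNeighbors [DecidableRel G.Adj] {v : Fin n} {u : ℕ} :
    u ∈ natNeighbors (G := G) v ↔ NatAdj G v u := by
  simp only [natNeighbors, Finset.mem_map, SimpleGraph.mem_neighborFinset,
    Fin.valEmbedding_apply]
  constructor
  · rintro ⟨w, hw, rfl⟩; exact natAdj_coe.2 hw
  · rintro ⟨hv, hu, h⟩; exact ⟨⟨u, hu⟩, h, rfl⟩

lemma card_natNeighbors [DecidableRel G.Adj] (v : Fin n) :
    (natNeighbors (G := G) v).card = G.degree v := by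
  rw [natNeighbors, Finset.card_map, SimpleGraph.card_neighborFinset_eq_degree]

lemma label_ne_zero_of_center [DecidableRel G.Adj] {σ₁ σ₂ : State}
    (hd : Dominated G (centers n σ₁) n σ₂) {v : Fin n}
    (hv : ¬ ∀ u ∈ natNeighbors (G := G) v, σ₁.mem .cluster u 0 = 0) : σ₂.label v ≠ 0 := by
  push Not at hv
  obtain ⟨u, hu, hu0⟩ := hv
  rw [mem_natNeighbors] at hu
  exact hd u ⟨hu.lt_right, hu0⟩ hu.lt_right v hu.symm

open Classical in
/-- The probability that the samples miss a cluster with at least `T` neighbours of a vertex. -/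
lemma expect_exists_missed_le {S : Set ℕ} {σ : State} (h : Clustering G S σ) (k T : ℕ) {δ : ℝ≥0∞}
    (hδ : ∀ v < n, ∀ a, T ≤ a → ∃ q : ℝ≥0∞, (∀ m : ℕ, 0 < m → m ≤ L.deg v →
      ((m - a : ℕ) : ℝ≥0∞) / m ≤ q) ∧ q ^ min (L.deg v) k ≤ δ) :
    expect ((sampleEdges k).run L σ) (fun o =>
      if ∀ v < n, ∀ x ≤ n, σ.label v ≠ x → T ≤ clusterDeg L σ.label v x →
        o.1.mem .meets v x ≠ 0 then 0 else 1) ≤ n * ((n + 1) * δ) := by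
  set f : ℕ → ℕ → State × ℕ → ℝ≥0∞ := fun v x o =>
    if σ.label v ≠ x ∧ T ≤ clusterDeg L σ.label v x then
      (if o.1.mem .meets v x = 0 then 1 else 0) else 0 with hf
  have h1 : ∀ v < n, ∀ x, expect ((sampleEdges k).run L σ) (f v x) ≤ δ := fun v hv x => by
    by_cases hx : σ.label v ≠ x ∧ T ≤ clusterDeg L σ.label v x
    · simp only [hf, hx, and_self, if_true, ne_eq, not_false_eq_true]
      obtain ⟨q, hq, hq'⟩ := hδ v hv _ hx.2
      exact (expect_sampleEdges_le k h.resting hv hx.1 hq).trans hq'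
    · simp only [hf, hx, if_false, expect_const]
      exact bot_le
  -- Union bound over `n` vertices and the `n + 1` possible labels `0, …, n`, where `0` means
  -- unclustered.
  calc _ ≤ expect ((sampleEdges k).run L σ) (fun o =>
        ∑ v ∈ Finset.range n, ∑ x ∈ Finset.range (n + 1), f v x o) := by
        refine expect_mono fun o _ => ?_
        split_ifs with hall
        · exact bot_le
        · push Not at hall
          obtain ⟨v, hv, x, hx, h1, h2, h3⟩ := hall
          calc (1 : ℝ≥0∞) = f v x o := by simp [hf, h1, h2, h3]
            _ ≤ ∑ x ∈ Finset.range (n + 1), f v x o :=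
              Finset.single_le_sum (f := fun x => f v x o) (fun _ _ => bot_le)
                (Finset.mem_range.2 (by omega))
            _ ≤ _ := Finset.single_le_sum
              (f := fun v => ∑ x ∈ Finset.range (n + 1), f v x o) (fun _ _ => bot_le)
                (Finset.mem_range.2 hv)
    _ = ∑ v ∈ Finset.range n, ∑ x ∈ Finset.range (n + 1),
          expect ((sampleEdges k).run L σ) (f v x) := by
        rw [expect_finset_sum]
        refine Finset.sum_congr rfl fun v _ => ?_
        rw [expect_finset_sum]
    _ ≤ ∑ v ∈ Finset.range n, ∑ x ∈ Finset.range (n + 1), δ :=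
        Finset.sum_le_sum fun v hv => Finset.sum_le_sum fun x _ => h1 v (Finset.mem_range.1 hv) x
    _ = _ := by simp

/-- A bound on the number of edges of the spanner, if there are at most `B` clusters, and every
vertex meets the clusters with at least `T` of its neighbours. -/
def edgeBound (n B T : ℕ) : ℕ := 2 * n + 2 * (n * B) + T * (n * B)

/-- A bound on the number of steps, if there are at most `B` clusters, the degrees are at most `Δ`,
and every vertex samples at most `k` edges. -/
def stepBound (n B Δ k : ℕ) : ℕ :=
  n * (accessCost n + 11) + 2 + (n * (accessCost n + 12) + B * (Δ * (4 * accessCost n + 20)) + 2 +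
    (n * (k * (11 * accessCost n + 80) + 11) + 2))

open Classical in
/-- The probability of failure of the three steps of the preprocessing. -/
lemma expect_failure_le [DecidableRel G.Adj] (p : ℝ) (k B Δ T : ℕ) {δ : ℝ≥0∞}
    (hp : ∀ v, (1 - min 1 (ENNReal.ofReal p)) ^ G.degree v ≤ δ)
    (hB : (1 + min 1 (ENNReal.ofReal p)) ^ n ≤ δ * 2 ^ B)
    (hΔ : ∀ v, L.deg v ≤ Δ)
    (hδ : ∀ v < n, ∀ a, T ≤ a → ∃ q : ℝ≥0∞, (∀ m : ℕ, 0 < m → m ≤ L.deg v →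
      ((m - a : ℕ) : ℝ≥0∞) / m ≤ q) ∧ q ^ min (L.deg v) k ≤ δ)
    (s : Set (State × ℕ))
    (hs : ∀ σ : State, ∀ t : ℕ, t ≤ stepBound n B Δ k → ∀ H ≤ G,
      (∀ u v : Fin n, G.Adj u v → (answer σ u v = true ↔ H.Adj u v)) → IsSpanner 3 G H →
      H.edgeSet.ncard ≤ edgeBound n B T → (σ, t) ∈ s) :
    expect ((Cmd.seq (chooseCenters p) (.seq assignClusters (sampleEdges k))).run L
      (State.init n)) (fun o => if o ∈ s then 0 else 1) ≤
      n * δ + δ + n * ((n + 1) * δ) := by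
  set f : Fin n → State × ℕ → ℝ≥0∞ := fun v o =>
    if ∀ u ∈ natNeighbors (G := G) v, o.1.mem .cluster u 0 = 0 then 1 else 0 with hf
  -- This is at least 1 as soon as there are `B` centres, and its mean is controlled by the
  -- exponential moment.
  set g : State × ℕ → ℝ≥0∞ := fun o => 2 ^ numCenters n o.1 * (2 ^ B)⁻¹ with hg
  have hle1 : ∀ (o : State × ℕ), (if o ∈ s then (0 : ℝ≥0∞) else 1) ≤ 1 := fun o => by
    split_ifs <;> simp
  -- Conditionally on step 1: if its outcome is bad, `f` or `g` already pays for certain failure;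
  -- otherwise only a missed cluster in step 3 can cause failure.
  have key : ∀ o ∈ ((chooseCenters p).run L (State.init n)).support,
      expect ((Cmd.seq assignClusters (sampleEdges k)).run L o.1)
        (fun o' => if (o'.1, o.2 + o'.2) ∈ s then 0 else 1) ≤
        ∑ v, f v o + g o + n * ((n + 1) * δ) := by
    intro o ho
    obtain ⟨hcen, hcost⟩ := chooseCenters_support L p o ho
    by_cases hnone : ∃ v, f v o = 1
    · obtain ⟨v, hv⟩ := hnone
      refine (expect_le_of_forall fun o' _ => hle1 _).trans ?_
      rw [add_assoc]
      refine le_add_right ?_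
      rw [← hv]
      exact Finset.single_le_sum (f := fun v => f v o) (fun _ _ => bot_le) (Finset.mem_univ v)
    by_cases hnum : B ≤ numCenters n o.1
    · refine (expect_le_of_forall fun o' _ => hle1 _).trans ?_
      refine le_add_right (le_add_left ?_)
      simp only [hg]
      rw [← div_eq_mul_inv, ENNReal.le_div_iff_mul_le (by simp) (by simp), one_mul]
      exact pow_le_pow_right₀ (by norm_num) hnum
    refine le_add_left ?_
    rw [expect_seq]
    refine expect_le_of_forall fun o₂ ho₂ => ?_
    obtain ⟨hC, hdom, hcost₂⟩ := assignClusters_support L hΔ hcen o₂ ho₂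
    have hcl : ∀ v < n, o₂.1.label v ≠ 0 := fun v hv => by
      refine label_ne_zero_of_center (v := ⟨v, hv⟩) hdom fun h0 => hnone ⟨⟨v, hv⟩, ?_⟩
      exact if_pos h0
    refine le_trans (expect_mono fun o₃ ho₃ => ?_) (expect_exists_missed_le L hC k T hδ)
    split_ifs with h1 h2 h2 <;> try simp
    refine h1 ?_
    obtain ⟨⟨R, hR⟩, hcost₃⟩ := sampleEdges_support k hC.resting o₃ ho₃
    set N : Finset ℕ := (Finset.range n).filter fun u => o.1.mem .cluster u 0 ≠ 0 with hN
    have hNB : N.card ≤ B := by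
      have : N.card = numCenters n o.1 := rfl
      omega
    refine hs _ _ ?_ (answerGraph G o₃.1 fun _ _ => hR.answer_symm hC)
      (fun _ _ (h : (answerGraph G o₃.1 _).Adj _ _) => h.1)
      (fun u v huv => ⟨fun h => ⟨huv, h⟩, fun h => h.2⟩)
      (hR.isSpanner hC (fun c hc => hc.1) hcl) ?_
    · have : numCenters n o.1 * (Δ * (4 * accessCost n + 20)) ≤
          B * (Δ * (4 * accessCost n + 20)) := Nat.mul_le_mul_right _ (by omega)
      unfold stepBound
      omega
    · refine (hR.ncard_edgeSet_le L hC hcl (N := N) (fun c hc => ?_) h2 fun c hc => hc.1).trans ?_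
      · exact Finset.mem_filter.2 ⟨Finset.mem_range.2 hc.1, hc.2⟩
      · unfold edgeBound
        gcongr
  rw [expect_seq]
  refine (expect_mono key).trans ?_
  rw [expect_add, expect_add, expect_finset_sum, expect_const]
  gcongr
  · calc _ ≤ ∑ _v : Fin n, δ := Finset.sum_le_sum fun v _ => by
          refine (expect_no_center_le L p (natNeighbors (G := G) v) fun u hu =>
            (mem_natNeighbors.1 hu).lt_right).trans ?_
          rw [card_natNeighbors]
          exact hp v
      _ = n * δ := by simp
  · rw [hg, expect_mul_const, ← div_eq_mul_inv]
    exact ENNReal.div_le_of_le_mul ((expect_two_pow_numCenters_le L p).trans hB)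

end

/-! ## Estimates -/

/-- For `p < 1` this is `1 - p ≤ exp(-p)`; for `p ≥ 1` the left side is `0 ^ d`, which vanishes
because `d > 0`. -/
lemma one_sub_min_pow_le {p y : ℝ} (hp : 0 ≤ p) {d : ℕ} (hd : 0 < d) (h : y ≤ p * d) :
    (1 - min 1 (ENNReal.ofReal p)) ^ d ≤ ENNReal.ofReal (Real.exp (-y)) := by
  rcases le_or_gt 1 p with h1 | h1
  · rw [min_eq_left (ENNReal.one_le_ofReal.2 h1)]
    simp [hd.ne']
  · rw [min_eq_right (ENNReal.ofReal_le_one.2 h1.le), ← ENNReal.ofReal_one,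
      ← ENNReal.ofReal_sub _ hp, ← ENNReal.ofReal_pow (by linarith)]
    refine ENNReal.ofReal_le_ofReal ?_
    calc (1 - p) ^ d ≤ Real.exp (-p) ^ d :=
          pow_le_pow_left₀ (by linarith) (Real.one_sub_le_exp_neg p) d
      _ = Real.exp (-(p * d)) := by rw [← Real.exp_nat_mul]; congr 1; ring
      _ ≤ _ := Real.exp_le_exp.2 (by linarith)

/-- The left side is at most `exp(pn)`, while `B ≥ 4pn` and `log 2 ≥ 1/2` give `2 ^ B ≥ exp(2pn)`;
the surplus `exp(pn)` absorbs `exp(y)`. -/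
lemma one_add_min_pow_le {p y : ℝ} (hp : 0 ≤ p) {n B : ℕ} (h : 4 * (p * n) ≤ B)
    (hy : y ≤ p * n) :
    (1 + min 1 (ENNReal.ofReal p)) ^ n ≤ ENNReal.ofReal (Real.exp (-y)) * 2 ^ B := by
  have hpn : 0 ≤ p * n := by positivity
  have h2 : (2 : ℝ≥0∞) ^ B = ENNReal.ofReal (2 ^ B) := by
    rw [ENNReal.ofReal_pow (by norm_num)]; norm_num
  calc (1 + min 1 (ENNReal.ofReal p)) ^ n ≤ (ENNReal.ofReal (1 + p)) ^ n := by
        rw [ENNReal.ofReal_add (by norm_num) hp, ENNReal.ofReal_one]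
        gcongr
        exact min_le_right _ _
    _ = ENNReal.ofReal ((1 + p) ^ n) := by rw [ENNReal.ofReal_pow (by linarith)]
    _ ≤ ENNReal.ofReal (Real.exp (-y) * 2 ^ B) := by
        refine ENNReal.ofReal_le_ofReal ?_
        have h3 : (2 : ℝ) ^ B = Real.exp (B * Real.log 2) := by
          rw [Real.exp_nat_mul, Real.exp_log (by norm_num)]
        have h4 : (1 / 2 : ℝ) ≤ Real.log 2 := by have := Real.log_two_gt_d9; linarith
        rw [h3, ← Real.exp_add]
        calc (1 + p) ^ n ≤ Real.exp p ^ n :=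
              pow_le_pow_left₀ (by linarith) (by linarith [Real.add_one_le_exp p]) n
          _ = Real.exp (p * n) := by rw [← Real.exp_nat_mul]; congr 1; ring
          _ ≤ _ := Real.exp_le_exp.2 (by nlinarith)
    _ = _ := by rw [ENNReal.ofReal_mul (Real.exp_pos _).le, h2]

/-- The witness is `exp(-a/d)`, as `m ≤ d` gives `1 - a/m ≤ 1 - a/d`. The two hypotheses on `y`
serve the two values of `min d k`: all edges sampled, or `k` of them. -/
lemma exists_miss_bound {d k a : ℕ} (hd : 0 < d) {y : ℝ} (hy : y ≤ a) (hk : y * d ≤ a * k) :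
    ∃ q : ℝ≥0∞, (∀ m : ℕ, 0 < m → m ≤ d → ((m - a : ℕ) : ℝ≥0∞) / m ≤ q) ∧
      q ^ min d k ≤ ENNReal.ofReal (Real.exp (-y)) := by
  have hd' : (0 : ℝ) < d := by exact_mod_cast hd
  refine ⟨ENNReal.ofReal (Real.exp (-(a / d))), fun m hm hmd => ?_, ?_⟩
  · have hm' : (0 : ℝ) < m := by exact_mod_cast hm
    have hmd' : (m : ℝ) ≤ d := by exact_mod_cast hmd
    rw [← ENNReal.ofReal_natCast, ← ENNReal.ofReal_natCast m, ← ENNReal.ofReal_div_of_pos hm']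
    refine ENNReal.ofReal_le_ofReal ?_
    rcases le_total m a with h | h
    · rw [Nat.sub_eq_zero_of_le h]
      simpa using (Real.exp_pos _).le
    · rw [Nat.cast_sub h, sub_div, div_self hm'.ne']
      have : (a : ℝ) / d ≤ a / m := by gcongr
      linarith [Real.one_sub_le_exp_neg ((a : ℝ) / d)]
  · rw [← ENNReal.ofReal_pow (Real.exp_pos _).le, ← Real.exp_nat_mul]
    refine ENNReal.ofReal_le_ofReal (Real.exp_le_exp.2 ?_)
    have h1 : y ≤ (min d k : ℕ) * ((a : ℝ) / d) := by
      rcases le_total d k with h | h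
      · rw [min_eq_left h, mul_div_cancel₀ _ hd'.ne']; exact hy
      · rw [min_eq_right h, ← mul_div_assoc, le_div_iff₀ hd']; linarith
    linarith

/-- Since `log 2 > 2/3`, both `log₂ n` and `1` are at most `(3/2) log n` for `n ≥ 2`. -/
lemma accessCost_le {n : ℕ} (hn : 2 ≤ n) : (accessCost n : ℝ) ≤ 3 * Real.log n := by
  have h1 : ((Nat.log 2 n : ℕ) : ℝ) ≤ Real.logb 2 n := by
    exact_mod_cast Real.natLog_le_logb n 2
  have h2 : Real.log 2 ≤ Real.log n :=
    Real.log_le_log (by norm_num) (by exact_mod_cast hn)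
  have h3 := Real.log_two_gt_d9
  have h4 : Real.logb 2 n ≤ 3 / 2 * Real.log n := by
    rw [Real.logb, div_le_iff₀ (by linarith)]
    nlinarith
  unfold accessCost
  push_cast
  linarith

lemma query_cost_le {n : ℕ} (hn : 2 ≤ n) :
    (query.cost n : ℝ) ≤ 200 * Real.log n ^ 2 := by
  have h1 : query.cost n ≤ 10 * accessCost n + 40 := by
    simp only [query, Test.cost, Expr.cost, clusterOf]; omega
  have h2 : (query.cost n : ℝ) ≤ 10 * accessCost n + 40 := by exact_mod_cast h1
  have h3 := accessCost_le hn
  have h4 : Real.log 2 ≤ Real.log n :=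
    Real.log_le_log (by norm_num) (by exact_mod_cast hn)
  have h5 := Real.log_two_gt_d9
  nlinarith

/-- The estimate of the number of edges. -/
lemma edgeBound_le {n B T : ℕ} {C D r l : ℝ} (hC : 1 ≤ C) (hD : 0 < D) (hr : 1 ≤ r)
    (hrD : r ≤ C * D) (hDn : D ≤ C * n) (hl : 2 / 3 ≤ l) (hB : (B : ℝ) ≤ 500 * C * n * l / D)
    (hT : (T : ℝ) ≤ D / r + 102 * l) :
    (edgeBound n B T : ℝ) ≤ 60000 * C ^ 2 * l ^ 2 * (n ^ 2 / r) := by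
  have hr0 : 0 < r := by linarith
  have hn0 : (0 : ℝ) ≤ n := Nat.cast_nonneg n
  set X : ℝ := C ^ 2 * (n ^ 2 / r) with hX
  have hX0 : 0 ≤ X := by positivity
  -- This uses `r ≤ CD ≤ C²n`.
  have hnX : (n : ℝ) ≤ X := by
    rw [hX, ← mul_div_assoc, le_div_iff₀ hr0]
    calc n * r ≤ n * (C * (C * n)) := by gcongr; exact hrD.trans (by gcongr)
      _ = _ := by ring
  -- The condition `r ≤ CD` trades `1/D` for `C/r`; in `h2` the factor `D/r` of the threshold
  -- cancels `D` instead.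
  have h1 : C * n * l / D * n ≤ l * X := by
    rw [hX, div_mul_eq_mul_div, div_le_iff₀ hD]
    calc C * n * l * n = l * (C * (n ^ 2 / r)) * r := by field_simp
      _ ≤ l * (C * (n ^ 2 / r)) * (C * D) := by gcongr
      _ = _ := by ring
  have h2 : C * n * l / D * n * (D / r) ≤ l * X := by
    have : C * n * l / D * n * (D / r) = l * (C * (n ^ 2 / r)) := by field_simp
    rw [this, hX]
    gcongr
    nlinarith
  have hnB : (n : ℝ) * B ≤ 500 * (C * n * l / D * n) := by
    calc (n : ℝ) * B ≤ n * (500 * C * n * l / D) := by gcongr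
      _ = _ := by ring
  have hTB : (T : ℝ) * (n * B) ≤ 500 * (l * X) + 51000 * (l * (l * X)) := by
    calc (T : ℝ) * (n * B) ≤ (D / r + 102 * l) * (500 * (C * n * l / D * n)) := by gcongr
      _ = 500 * (C * n * l / D * n * (D / r)) + 51000 * (l * (C * n * l / D * n)) := by ring
      _ ≤ _ := by gcongr
  have hlX : X ≤ 3 / 2 * (l * X) := by nlinarith
  have hllX : l * X ≤ 3 / 2 * (l * (l * X)) := by nlinarith [mul_nonneg (by linarith : 0 ≤ l) hX0]
  have hgoal : 60000 * C ^ 2 * l ^ 2 * (n ^ 2 / r) = 60000 * (l * (l * X)) := by rw [hX]; ring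
  rw [hgoal]
  unfold edgeBound
  push_cast
  nlinarith

/-- The estimate of the number of steps. -/
lemma stepBound_le {n B Δ k : ℕ} {C D r l : ℝ} (hn : 1 ≤ n) (hC : 1 ≤ C) (hD : 0 < D) (hr : 1 ≤ r)
    (hl : 2 / 3 ≤ l) (hA : (accessCost n : ℝ) ≤ 3 * l)
    (hB : (B : ℝ) ≤ 500 * C * n * l / D) (hΔ : (Δ : ℝ) ≤ C * D)
    (hk : (k : ℝ) ≤ 102 * C * r * l) :
    (stepBound n B Δ k : ℝ) ≤ 60000 * C ^ 2 * l ^ 2 * (n * r) := by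
  have hn' : (1 : ℝ) ≤ n := by exact_mod_cast hn
  set Y : ℝ := n * l ^ 2 with hY
  set Z : ℝ := C ^ 2 * l ^ 2 * (n * r) with hZ
  have hY0 : 0 ≤ Y := by positivity
  have hCr : 1 ≤ C * r := by nlinarith
  have hYZ : C * r * Y ≤ Z := by
    rw [hZ, hY]
    calc C * r * (n * l ^ 2) = C * (l ^ 2 * (n * r)) := by ring
      _ ≤ C ^ 2 * (l ^ 2 * (n * r)) := by gcongr; nlinarith
      _ = _ := by ring
  have hYZ' : C ^ 2 * Y ≤ Z := by
    rw [hZ, hY]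
    calc C ^ 2 * (n * l ^ 2) = C ^ 2 * l ^ 2 * (n * 1) := by ring
      _ ≤ _ := by gcongr
  have hY1 : Y ≤ Z := (by nlinarith : Y ≤ C * r * Y).trans hYZ
  have hnl : (n : ℝ) * l ≤ 3 / 2 * Y := by rw [hY]; nlinarith
  have hn1 : (n : ℝ) ≤ 3 / 2 * (n * l) := by nlinarith
  have e1 : (n : ℝ) * (accessCost n + 11) ≤ n * l * 20 := by
    calc (n : ℝ) * (accessCost n + 11) ≤ n * (l * 20) := by gcongr; linarith
      _ = _ := by ring
  have e2 : (n : ℝ) * (accessCost n + 12) ≤ n * l * 21 := by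
    calc (n : ℝ) * (accessCost n + 12) ≤ n * (l * 21) := by gcongr; linarith
      _ = _ := by ring
  -- The degree bound `CD` cancels the `1/D` in the number of centres, so step 2 takes time nearly
  -- linear in `n`.
  have e3 : (B : ℝ) * (Δ * (4 * accessCost n + 20)) ≤ 21000 * Z := by
    calc (B : ℝ) * (Δ * (4 * accessCost n + 20)) ≤
          500 * C * n * l / D * (C * D * (42 * l)) := by gcongr; linarith
      _ = 21000 * (C ^ 2 * Y) := by rw [hY]; field_simp; ring
      _ ≤ _ := by gcongr
  have e4 : (n : ℝ) * (k * (11 * accessCost n + 80) + 11) ≤ 15606 * Z + 11 * n := by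
    calc (n : ℝ) * (k * (11 * accessCost n + 80) + 11) ≤
          n * (102 * C * r * l * (153 * l) + 11) := by gcongr; linarith
      _ = 15606 * (C * r * Y) + 11 * n := by rw [hY]; ring
      _ ≤ _ := by gcongr
  have hgoal : 60000 * C ^ 2 * l ^ 2 * (n * r) = 60000 * Z := by rw [hZ]; ring
  rw [hgoal]
  unfold stepBound
  push_cast
  linarith

/-! ## The two cases of the preprocessing -/

open Classical in
lemma ofReal_one_sub_le_of_expect_le {α : Type*} (p : PMF α) (s : Set α) {x : ℝ} (hx : 0 ≤ x)
    (h : expect p (fun a => if a ∈ s then 0 else 1) ≤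
      ENNReal.ofReal x) :
    ENNReal.ofReal (1 - x) ≤ p.toOuterMeasure s := by
  rw [ENNReal.ofReal_sub _ hx, ENNReal.ofReal_one, tsub_le_iff_right]
  exact (one_le_toOuterMeasure_add p s).trans (by gcongr)

section
variable {n : ℕ} {G : SimpleGraph (Fin n)} (L : AdjList G)

/-- The preprocessing is one deterministic write of `accessCost n + 3` steps, and the spanner is `G`
itself. -/
lemma successProb_eq_one_of_le {C D r E T q : ℝ} (hD : D ≤ (n : ℝ) ^ (1 / 2 : ℝ))
    (hE : (G.edgeSet.ncard : ℝ) ≤ E) (hT : (accessCost n : ℝ) + 3 ≤ T)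
    (hq : (query.cost n : ℝ) ≤ q) : 1 ≤ successProb L C D r E T q := by
  unfold successProb
  rw [preprocess, if_pos hD]
  simp only [Cmd.run, PMF.toOuterMeasure_pure_apply]
  rw [if_pos]
  refine ⟨?_, G, ⟨le_rfl, fun s t hst => ?_, hq⟩,
    isSpanner_of_adj (by norm_num) le_rfl fun s t hst => ?_, hE⟩
  · simp only [Expr.cost]
    push_cast
    linarith
  · simp [answer, query, Test.eval, Expr.eval, hst]
  · exact (edist_le_one (Or.inr hst)).trans (by norm_num)

/-- The sum is `(n+1)² n⁻⁵`, and `n + 1 ≤ n²` for `n ≥ 2`. -/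
lemma failure_sum_le (hn : 2 ≤ n) :
    (n : ℝ≥0∞) * ENNReal.ofReal (Real.exp (-(5 * Real.log n))) +
      ENNReal.ofReal (Real.exp (-(5 * Real.log n))) +
      n * ((n + 1) * ENNReal.ofReal (Real.exp (-(5 * Real.log n)))) ≤
      ENNReal.ofReal (1 / n) := by
  have hn' : (2 : ℝ) ≤ n := by exact_mod_cast hn
  have h5 : Real.exp (-(5 * Real.log n)) = 1 / (n : ℝ) ^ 5 := by
    rw [Real.exp_neg, one_div]
    congr 1
    rw [show (5 : ℝ) * Real.log n = (5 : ℕ) * Real.log n by norm_num, Real.exp_nat_mul,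
      Real.exp_log (by linarith)]
  rw [h5]
  have h0 : (0 : ℝ) ≤ 1 / (n : ℝ) ^ 5 := by positivity
  have : (n : ℝ≥0∞) * ENNReal.ofReal (1 / (n : ℝ) ^ 5) + ENNReal.ofReal (1 / (n : ℝ) ^ 5) +
      n * ((n + 1) * ENNReal.ofReal (1 / (n : ℝ) ^ 5)) =
      ENNReal.ofReal ((n + 1) ^ 2 * (1 / (n : ℝ) ^ 5)) := by
    rw [ENNReal.ofReal_mul (by positivity), ENNReal.ofReal_pow (by positivity),
      ENNReal.ofReal_add (by positivity) (by norm_num), ENNReal.ofReal_natCast, ENNReal.ofReal_one]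
    ring
  rw [this]
  refine ENNReal.ofReal_le_ofReal ?_
  rw [mul_one_div, div_le_div_iff₀ (by positivity) (by positivity)]
  have h1 : ((n : ℝ) + 1) ^ 2 ≤ n ^ 4 := by
    have : (n : ℝ) + 1 ≤ n ^ 2 := by nlinarith
    calc ((n : ℝ) + 1) ^ 2 ≤ (n ^ 2) ^ 2 := by gcongr
      _ = _ := by ring
  nlinarith [mul_le_mul_of_nonneg_right h1 (by linarith : (0 : ℝ) ≤ n)]

lemma le_successProb_of_lt [DecidableRel G.Adj] (hn : 2 ≤ n) {C D r E T q : ℝ} (hC : 1 ≤ C)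
    (hdeg : ∀ v : Fin n, D / C ≤ (G.degree v : ℝ) ∧ (G.degree v : ℝ) ≤ C * D)
    (hD : (n : ℝ) ^ (1 / 2 : ℝ) < D) (hr : 1 ≤ r) (hrD : r ≤ C * D)
    (hE : 60000 * C ^ 2 * Real.log n ^ 2 * ((n : ℝ) ^ 2 / r) ≤ E)
    (hT : 60000 * C ^ 2 * Real.log n ^ 2 * (n * r) ≤ T)
    (hq : (query.cost n : ℝ) ≤ q) :
    ENNReal.ofReal (1 - 1 / n) ≤ successProb L C D r E T q := by
  set l := Real.log n with hl
  have hl1 : 2 / 3 ≤ l := by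
    have h1 : Real.log 2 ≤ l := Real.log_le_log (by norm_num) (by exact_mod_cast hn)
    linarith [Real.log_two_gt_d9]
  have hn0 : (0 : ℝ) < n := by exact_mod_cast (by omega : 0 < n)
  have hD0 : 0 < D := lt_of_le_of_lt (by positivity) hD
  have hC0 : 0 < C := by linarith
  have hr0 : 0 < r := by linarith
  have hdeg0 : ∀ v : Fin n, 0 < G.degree v := fun v => by
    have : 0 < D / C := by positivity
    exact_mod_cast this.trans_le (hdeg v).1
  have hDn : D ≤ C * n := by
    have v : Fin n := ⟨0, by omega⟩
    have h1 : (G.degree v : ℝ) ≤ n := by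
      have := G.degree_lt_card_verts v
      rw [Fintype.card_fin] at this
      exact_mod_cast this.le
    have h2 := (hdeg v).1
    rw [div_le_iff₀ hC0] at h2
    nlinarith
  set p : ℝ := 100 * C * l / D with hp
  have hp0 : 0 ≤ p := by positivity
  have hpn : 100 * l ≤ p * n := by
    rw [hp, div_mul_eq_mul_div, le_div_iff₀ hD0]
    calc 100 * l * D ≤ 100 * l * (C * n) := by gcongr
      _ = _ := by ring
  -- `B` is four times the bound `pn` on the mean number of centres. In `t`, the term `100 * l`
  -- handles vertices all of whose edges are sampled, and `D / r` those with only `k` samples.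
  set B : ℕ := ⌈4 * (p * n)⌉₊ with hB
  set t : ℕ := ⌈D / r + 100 * l⌉₊ with ht
  set k : ℕ := ⌈100 * C * r * l⌉₊ with hk
  have hΔ : ∀ v, L.deg v ≤ ⌊C * D⌋₊ := fun v => by
    by_cases hv : v < n
    · rw [show v = ((⟨v, hv⟩ : Fin n) : ℕ) from rfl, L.deg_eq]
      exact Nat.le_floor (hdeg _).2
    · simp [AdjList.deg, hv]
  have hBle : (B : ℝ) ≤ 500 * C * n * l / D := by
    have h1 := (Nat.ceil_lt_add_one (show 0 ≤ 4 * (p * n) by positivity)).le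
    calc (B : ℝ) ≤ 4 * (p * n) + 1 := h1
      _ ≤ 5 * (p * n) := by linarith
      _ = _ := by rw [hp]; ring
  have htle : (t : ℝ) ≤ D / r + 102 * l := by
    have h1 := (Nat.ceil_lt_add_one (show 0 ≤ D / r + 100 * l by positivity)).le
    linarith
  have hkle : (k : ℝ) ≤ 102 * C * r * l := by
    have h1 := (Nat.ceil_lt_add_one (show 0 ≤ 100 * C * r * l by positivity)).le
    have h2 : 1 ≤ C * r := by nlinarith
    nlinarith
  refine ofReal_one_sub_le_of_expect_le _ _ (by positivity) ?_
  rw [preprocess, if_neg (not_le.2 hD)]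
  refine (expect_failure_le L p k B ⌊C * D⌋₊ t
    (δ := ENNReal.ofReal (Real.exp (-(5 * l)))) ?_ ?_ hΔ ?_ _ ?_).trans (failure_sum_le hn)
  · intro v
    refine one_sub_min_pow_le hp0 (hdeg0 v) ?_
    calc 5 * l ≤ p * (D / C) := by
          have : p * (D / C) = 100 * l := by rw [hp]; field_simp
          linarith
      _ ≤ _ := by gcongr; exact (hdeg v).1
  · exact one_add_min_pow_le hp0 (Nat.le_ceil _) (by linarith)
  · intro v hv a ha
    have hdv : L.deg v = G.degree ⟨v, hv⟩ := L.deg_eq ⟨v, hv⟩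
    have ha' : D / r + 100 * l ≤ a := (Nat.le_ceil _).trans (by exact_mod_cast ha)
    have hDr : 0 < D / r := by positivity
    refine exists_miss_bound (by rw [hdv]; exact hdeg0 _) (by linarith) ?_
    rw [hdv]
    -- A cluster with at least `D/r` of at most `CD` neighbours is hit `100l` times on average by
    -- `100Crl` samples.
    calc 5 * l * (G.degree ⟨v, hv⟩ : ℝ) ≤ 100 * l * (C * D) := by
          have := (hdeg ⟨v, hv⟩).2
          gcongr
          norm_num
      _ = D / r * (100 * C * r * l) := by field_simp
      _ ≤ a * k := by
          gcongr
          · linarith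
          · exact Nat.le_ceil _
  · intro σ s hs H hH hans hspan hcard
    refine ⟨?_, H, ⟨hH, hans, hq⟩, hspan, ?_⟩
    · refine le_trans ?_ ((stepBound_le (by omega) hC hD0 hr hl1 (accessCost_le hn) hBle
        (Nat.floor_le (by positivity)) hkle).trans hT)
      exact_mod_cast hs
    · refine le_trans ?_ ((edgeBound_le hC hD0 hr hrD hDn hl1 hBle htle).trans hE)
      exact_mod_cast hcard

lemma ncard_edgeSet_le_of_degree_le [DecidableRel G.Adj] {x : ℝ}
    (h : ∀ v : Fin n, (G.degree v : ℝ) ≤ x) : (G.edgeSet.ncard : ℝ) ≤ n * x := by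
  have h1 : G.edgeSet.ncard = G.edgeFinset.card := by
    rw [← SimpleGraph.coe_edgeFinset, Set.ncard_coe_finset]
  have h2 : (2 : ℝ) * G.edgeFinset.card = ∑ v, (G.degree v : ℝ) := by
    exact_mod_cast (G.sum_degrees_eq_twice_card_edges).symm
  have h3 : ∑ v, (G.degree v : ℝ) ≤ ∑ _v : Fin n, x := Finset.sum_le_sum fun v _ => h v
  rw [Finset.sum_const, Finset.card_univ, Fintype.card_fin, nsmul_eq_mul] at h3
  rw [h1]
  have : (0 : ℝ) ≤ G.edgeFinset.card := Nat.cast_nonneg _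
  linarith

end

end SpannerOracle

/-! ### The theorem, from the two regimes of `D`. -/

theorem mainTheorem7 :
    ∃ c : ℝ, 0 < c ∧ ∃ k : ℕ, ∀ C : ℝ, 1 ≤ C → ∃ K : ℝ, 0 < K ∧
      ∀ (n : ℕ), 1 ≤ n → ∀ (G : SimpleGraph (Fin n)) [DecidableRel G.Adj]
        (L : SpannerOracle.AdjList G) (D : ℝ),
        (∀ v : Fin n, D / C ≤ (G.degree v : ℝ) ∧ (G.degree v : ℝ) ≤ C * D) →
        (∀ r : ℝ, 1 ≤ r → r ≤ C * D →
          ENNReal.ofReal (1 - 1 / (n : ℝ) ^ c) ≤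
            SpannerOracle.successProb L C D r
              (K * Real.log n ^ k * ((n : ℝ) ^ 2 / r))
              (K * Real.log n ^ k * ((n : ℝ) * r))
              (K * Real.log n ^ k)) ∧
        ENNReal.ofReal (1 - 1 / (n : ℝ) ^ c) ≤
          SpannerOracle.successProb L C D ((n : ℝ) ^ (1 / 2 : ℝ))
            (K * Real.log n ^ k * (n : ℝ) ^ (3 / 2 : ℝ))
            (K * Real.log n ^ k * (n : ℝ) ^ (3 / 2 : ℝ))
            (K * Real.log n ^ k) := by
  -- The failure probability `1/n` gives `c = 1`; the factor `l²` in both `edgeBound_le` and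
  -- `stepBound_le` gives `k = 2`, and their common constant is `K`.
  refine ⟨1, one_pos, 2, fun C hC => ⟨60000 * C ^ 2, by positivity, ?_⟩⟩
  intro n hn G _ L D hdeg
  rw [Real.rpow_one]
  rcases hn.eq_or_lt with rfl | hn2
  -- For `n = 1` the logarithm is 0, but so is the probability `1 - 1/n` that is claimed.
  · simp
  have hn2 : 2 ≤ n := hn2
  have hn0 : (1 : ℝ) ≤ n := by exact_mod_cast hn
  have hC0 : 0 < C := by linarith
  set l := Real.log n with hl
  set x : ℝ := (n : ℝ) ^ (1 / 2 : ℝ) with hx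
  have hx1 : 1 ≤ x := Real.one_le_rpow hn0 (by norm_num)
  have hxx : x * x = n := by
    rw [hx, ← Real.rpow_add (by linarith)]; norm_num
  have hx3 : (n : ℝ) ^ (3 / 2 : ℝ) = n * x := by
    rw [hx, show (3 / 2 : ℝ) = 1 + 1 / 2 by norm_num, Real.rpow_add (by linarith), Real.rpow_one]
  have hx3' : (n : ℝ) ^ 2 / x = n * x := by
    rw [div_eq_iff (by linarith), mul_assoc, hxx, sq]
  have hl1 : 2 / 3 ≤ l := by
    have h1 : Real.log 2 ≤ l := Real.log_le_log (by norm_num) (by exact_mod_cast hn2)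
    linarith [Real.log_two_gt_d9]
  have hC1 : 1 ≤ C ^ 2 := one_le_pow₀ hC
  have hA := SpannerOracle.accessCost_le hn2
  have hK : (10000 : ℝ) * C ^ 2 ≤ 60000 * C ^ 2 * l ^ 2 := by
    have : (1 / 6 : ℝ) ≤ l ^ 2 := by nlinarith
    calc (10000 : ℝ) * C ^ 2 = 60000 * C ^ 2 * (1 / 6) := by ring
      _ ≤ _ := by gcongr
  have hq : (SpannerOracle.query.cost n : ℝ) ≤ 60000 * C ^ 2 * l ^ 2 :=
    (SpannerOracle.query_cost_le hn2).trans (by gcongr; linarith)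
  have hcost : (SpannerOracle.accessCost n : ℝ) + 3 ≤ 60000 * C ^ 2 * l ^ 2 := by
    nlinarith [mul_le_mul_of_nonneg_right hC1 (sq_nonneg l)]
  have hmul : ∀ y : ℝ, 1 ≤ y → (SpannerOracle.accessCost n : ℝ) + 3 ≤
      60000 * C ^ 2 * l ^ 2 * y := fun y hy =>
    hcost.trans (le_mul_of_one_le_right (by positivity) hy)
  have hprob : ENNReal.ofReal (1 - 1 / (n : ℝ)) ≤ 1 := by
    rw [ENNReal.ofReal_le_one]
    have : (0 : ℝ) ≤ 1 / n := by positivity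
    linarith
  rcases le_or_gt D x with hD | hD
  · have hE := SpannerOracle.ncard_edgeSet_le_of_degree_le fun v => (hdeg v).2
    constructor
    · intro r hr hrD
      have hD0 : 0 < D := by nlinarith
      refine hprob.trans (SpannerOracle.successProb_eq_one_of_le L hD (hE.trans ?_)
        (hmul _ (by nlinarith)) hq)
      calc (n : ℝ) * (C * D) ≤ C ^ 2 * ((n : ℝ) ^ 2 / r) := by
            rw [← mul_div_assoc, le_div_iff₀ (by linarith)]
            calc (n : ℝ) * (C * D) * r ≤ n * (C * x) * (C * x) := by
                  gcongr
                  exact hrD.trans (by gcongr)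
              _ = C ^ 2 * n * (x * x) := by ring
              _ = _ := by rw [hxx]; ring
        _ ≤ _ := by
            gcongr
            linarith
    -- Here `r = √n` may exceed `CD`, so this is not an instance of the first part; the bound `nCD ≤
    -- Cn√n` is used directly.
    · rw [hx3]
      refine hprob.trans (SpannerOracle.successProb_eq_one_of_le L hD (hE.trans ?_)
        (hmul _ (by nlinarith)) hq)
      calc (n : ℝ) * (C * D) ≤ C * (n * x) := by
            calc (n : ℝ) * (C * D) ≤ n * (C * x) := by gcongr
              _ = _ := by ring
        _ ≤ _ := by
            gcongr
            nlinarith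
  · refine ⟨fun r hr hrD => SpannerOracle.le_successProb_of_lt L hn2 hC hdeg hD hr hrD
      le_rfl le_rfl hq, ?_⟩
    -- Now `√n < D ≤ CD`, so `r = √n` is admissible, and `n²/r` and `nr` both equal `n√n`.
    refine SpannerOracle.le_successProb_of_lt L hn2 hC hdeg hD hx1 ?_ ?_ ?_ hq
    · nlinarith
    · rw [hx3, hx3']
    · rw [hx3]
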